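/- Let $\mathbb S^1\subset\mathbb R^2$ be the unit circle with arc length $\sigma$. For $\beta\in C_c^\infty(\mathbb R)$ with $\operatorname{supp}\beta\subset(\tfrac12,2)$ and $\Omega\in L^q(\mathbb S^1)$, put $$K^0(y)=\Omega\!\left(\frac{y}{|y|}\right)|y|^{-2}\beta(|y|),\qquad y=(y_1,y_2)\in\mathbb R^2\setminus\{0\},$$ $$T^0_\Omega(f_1,f_2)(x)=\int_{\mathbb R^2}K^0(y_1,y_2)\,f_1(x-y_1)\,f_2(x-y_2)\,dy_1\,dy_2,\qquad \langle g,h\rangle=\int_{\mathbb R} g\,\overline h .$$ The functions are complex-valued, and $\widehat f$ is the Fourier transform in the sense of tempered distributions, normalised by $\widehat f(\xi)=\int_{\mathbb R} f(x)e^{-2\pi i x\xi}\,dx$ for $f\in L^1(\mathbb R)$. **Theorem 1.2.** Let $1<q\le\infty$. There is $c>0$, depending only on $q$, and for every $\beta$ as above there is $C>0$, depending only on $q$ and $\beta$, such that the following holds for all $\lambda\ge1$, all $\Omega\in L^q(\mathbb S^1)$ and all $l_1,l_2,l_3$ with $\{l_1,l_2,l_3\}=\{1,2,3\}$. If $f_{l_1},f_{l_2}\in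 L^2(\mathbb R)$ and $f_{l_3}\in L^\infty(\mathbb R)$ satisfy $$\operatorname{supp}\widehat{f_{l_1}}\cup\operatorname{supp}\widehat{f_{l_2}}\subset\{\lambda\le|\xi|\le2\lambda\},\qquad \operatorname{supp}\widehat{f_{l_3}}\subset\{|\xi|\le2\lambda\},$$ then the integral defining $T^0_\Omega(f_1,f_2)(x)$ converges absolutely for almost every $x$, the function $T^0_\Omega(f_1,f_2)\,\overline{f_3}$ is integrable, and $$|\langle T^0_\Omega(f_1,f_2),f_3\rangle|\le C\,\lambda^{-c}\,\|\Omega\|_{L^q(\mathbb S^1)}\,\|f_{l_1}\|_{L^2(\mathbb R)}\,\|f_{l_2}\|_{L^2(\mathbb R)}\,\|f_{l_3}\|_{L^\infty(\mathbb R)} .$$ -/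

import Mathlib

open MeasureTheory
open scoped ENNReal ContDiff SchwartzMap FourierTransform ComplexConjugate

/-- The plane `ℝ²` with its Euclidean norm. -/
abbrev Plane : Type := EuclideanSpace ℝ (Fin 2)

/-- The unit circle `S¹ ⊂ ℝ²`. -/
abbrev UnitCircle : Type := Metric.sphere (0 : Plane) 1

/-- Arc length on `S¹`. -/
noncomputable def arcLength : Measure UnitCircle := (volume : Measure Plane).toSphere

/-- The direction `y / |y|` of a nonzero vector of the plane. -/
noncomputable def direction (y : Plane) (hy : y ≠ 0) : UnitCircle :=
  ⟨‖y‖⁻¹ • y, by simp [norm_smul, norm_ne_zero_iff.mpr hy]⟩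

open Classical in
/-- The single-scale kernel `K⁰(y) = Ω(y / |y|) |y|⁻² β(|y|)` (with the value `0` at `y = 0`). -/
noncomputable def singleScaleKernel (β : ℝ → ℂ) (Ω : UnitCircle → ℂ) (y : Plane) : ℂ :=
  if hy : y ≠ 0 then Ω (direction y hy) * ((‖y‖ ^ (-2 : ℤ) : ℝ) : ℂ) * β ‖y‖ else 0

/-- The single-scale bilinear operator
`T⁰_Ω(f₁, f₂)(x) = ∫_{ℝ²} K⁰(y₁, y₂) f₁(x - y₁) f₂(x - y₂) dy₁ dy₂`. -/
noncomputable def singleScaleOp (β : ℝ → ℂ) (Ω : UnitCircle → ℂ) (f₁ f₂ : ℝ → ℂ) (x : ℝ) : ℂ :=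
  ∫ y : Plane, singleScaleKernel β Ω y * f₁ (x - y 0) * f₂ (x - y 1)

/-- The Fourier support of a function `f ∈ Lᵖ(ℝ)`, `1 ≤ p ≤ ∞`: the support of the Fourier
transform (normalised with `exp (-2πi x ξ)`) of the tempered distribution defined by `f`. -/
noncomputable def fourierSupport {p : ℝ≥0∞} [Fact (1 ≤ p)] {f : ℝ → ℂ}
    (hf : MemLp f p (volume : Measure ℝ)) : Set ℝ :=
  Distribution.dsupport ⇑(𝓕 (Lp.toTemperedDistribution (hf.toLp f)) : 𝓢'(ℝ, ℂ))

/-!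
The trilinear form `⟨T(f₁, f₂), f₃⟩` is estimated on two parts of the angular function `Ω`, cut with
a parameter `t = λ ^ (1 / 6)`.

On the exceptional directions, where `|Ω| > t ‖Ω‖_q` or where the direction `(a, b)` is within `t⁻¹`
of the diagonal `a = b`, only the size of the kernel is used: the form is at most
`‖K‖₁ ‖f‖₂ ‖g‖₂ ‖h‖_∞` whichever slot carries the `L^∞` norm (`lintegral_triIntegrand_le`), and
Hölder's inequality on this set of length `O(t⁻¹)` gains `t ^ (-(1 - 1 / q))`
(`setLIntegral_exceptionalSet_le`).

On the other directions `Ω` is bounded and the oscillation is used. Since the kernel lives at scale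
one, the form is first localised: the product of three Gaussian windows integrates over their common
centre `s` to an explicit nonvanishing function of `y` (`integral_three_gaussWindow`), which can be
absorbed in the kernel, where it only multiplies the radial profile by `exp (τ r²)` with bounded `τ`.
So the form is an integral over `s` of forms in functions `g_i = f_i G(· - s)` that all belong to
`L¹ ∩ L²`, and the `L^∞` function contributes `‖g‖₂ ≤ ‖f‖_∞`. For a fixed direction `(a, b)`,
Parseval's identity turns the localised form into an integral of
`ĝ₁(ξ) ĝ₂(η) conj ĝ₃(ξ + η) ŵ(a ξ + b η)`, where the transform `ŵ` of the radial weight is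
`O(1 / (1 + ζ²))` (`enorm_directional_form_le`, `exists_enorm_fourier_radialWeight_le`).
After Cauchy–Schwarz in the direction and both frequencies, two facts are needed. The average of
`1 / (1 + (a ξ + b η)²)` over the circle is `O(1 / (1 + |ξ|))` and `O(1 / (1 + |η|))`
(`lintegral_circle_cauchyBump_le_left`, `lintegral_circle_cauchyBump_le_right`), which multiplies the
mass of an input by its inverse frequency. And with `ξ + η` fixed, the integral of that bump over `ξ`
is `π / |a - b|`, so that staying off the diagonal bounds the factor with `g₃`
(`lintegral_circle_dual_le`).

It remains to sum over the windows. One of the two functions of frequency at least `λ` is an input of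
the operator, and although a window blurs its frequency support, the average over `s` of
`∫ |ĝ(ξ)|² / (1 + |ξ|)` is still `O(λ⁻¹ ‖f‖₂²)`: as a function of `s`, the windowed Fourier transform
of `f` is up to a phase a windowed Fourier transform of `f̂`, and Plancherel's theorem in `s` applies
(`lintegral_fourier_windowed_le`).
-/

/-! ### Plancherel's theorem for integrable square-integrable functions -/

theorem Real.continuous_fourier_of_integrable {g : ℝ → ℂ} (hg : Integrable g) :
    Continuous (𝓕 g) :=
  VectorFourier.fourierIntegral_continuous Real.continuous_fourierChar
    (L := innerₗ ℝ) continuous_inner hg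

theorem Real.integral_fourier_mul_eq_of_integrable {f g : ℝ → ℂ} (hf : Integrable f)
    (hg : Integrable g) : ∫ ξ, 𝓕 f ξ * g ξ = ∫ x, f x * 𝓕 g x := by
  have := VectorFourier.integral_fourierIntegral_smul_eq_flip (μ := volume) (ν := volume)
    (L := innerₗ ℝ) Real.continuous_fourierChar continuous_inner hf hg
  simp only [flip_innerₗ, smul_eq_mul] at this
  exact this

/-- On `L¹ ∩ L²` the `L²` Fourier transform is given by the Fourier integral. -/
theorem MeasureTheory.MemLp.coeFn_fourier_toLp {g : ℝ → ℂ} (hg : Integrable g)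
    (hg2 : MemLp g 2) : (𝓕 (hg2.toLp g) : Lp ℂ 2 (volume : Measure ℝ)) =ᵐ[volume] 𝓕 g := by
  refine ae_eq_of_integral_contDiff_smul_eq ((Lp.memLp _).locallyIntegrable (by norm_num))
    (Real.continuous_fourier_of_integrable hg).locallyIntegrable fun φ hφ hc ↦ ?_
  have hφ₁ : HasCompactSupport (Complex.ofRealCLM ∘ φ) := hc.comp_left rfl
  have hφ₂ : ContDiff ℝ ∞ (Complex.ofRealCLM ∘ φ) := by fun_prop
  set u : 𝓢(ℝ, ℂ) := hφ₁.toSchwartzMap hφ₂ with hu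
  have hux : ∀ x, u x = (φ x : ℂ) := fun x ↦ rfl
  have key := congrArg (fun T : 𝓢'(ℝ, ℂ) ↦ T u)
    (Lp.fourier_toTemperedDistribution_eq (hg2.toLp g))
  simp only [TemperedDistribution.fourier_apply, Lp.toTemperedDistribution_apply] at key
  calc ∫ x, φ x • (𝓕 (hg2.toLp g) : Lp ℂ 2 (volume : Measure ℝ)) x
      = ∫ x, u x • (𝓕 (hg2.toLp g) : Lp ℂ 2 (volume : Measure ℝ)) x := by
        simp [hux]
    _ = ∫ x, (𝓕 u) x • (hg2.toLp g) x := key.symm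
    _ = ∫ x, g x * (𝓕 (u : ℝ → ℂ)) x := by
        refine integral_congr_ae ?_
        filter_upwards [hg2.coeFn_toLp] with x hx
        rw [hx, SchwartzMap.fourier_coe, smul_eq_mul, mul_comm]
    _ = ∫ x, 𝓕 g x * u x := (Real.integral_fourier_mul_eq_of_integrable hg u.integrable).symm
    _ = _ := by simp [hux, mul_comm]

theorem MeasureTheory.L2.integral_mul_conj_eq_inner {f g : ℝ → ℂ} (hf : MemLp f 2) (hg : MemLp g 2) :
    ∫ x, f x * conj (g x) = inner ℂ (hg.toLp g) (hf.toLp f) := by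
  rw [L2.inner_def]
  refine integral_congr_ae ?_
  filter_upwards [hf.coeFn_toLp, hg.coeFn_toLp] with x h1 h2
  rw [h1, h2]
  simp

/-- Parseval's identity between a function in `L²` and a function in `L¹ ∩ L²`. -/
theorem MeasureTheory.MemLp.integral_mul_conj_eq_fourier_toLp {f h : ℝ → ℂ} (hf : MemLp f 2)
    (hh : Integrable h) (hh2 : MemLp h 2) :
    ∫ x, f x * conj (h x) =
      ∫ ξ, (𝓕 (hf.toLp f) : Lp ℂ 2 (volume : Measure ℝ)) ξ * conj (𝓕 h ξ) := by
  rw [L2.integral_mul_conj_eq_inner hf hh2, ← Lp.inner_fourier_eq, L2.inner_def]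
  refine integral_congr_ae ?_
  filter_upwards [MemLp.coeFn_fourier_toLp hh hh2] with x h1
  rw [h1]
  simp

/-- Parseval's identity for the Fourier integrals of functions in `L¹ ∩ L²`. -/
theorem Real.integral_mul_conj_eq_integral_fourier {f h : ℝ → ℂ} (hf1 : Integrable f)
    (hf : MemLp f 2) (hh : Integrable h) (hh2 : MemLp h 2) :
    ∫ x, f x * conj (h x) = ∫ ξ, 𝓕 f ξ * conj (𝓕 h ξ) := by
  rw [hf.integral_mul_conj_eq_fourier_toLp hh hh2]
  refine integral_congr_ae ?_
  filter_upwards [MemLp.coeFn_fourier_toLp hf1 hf] with x h1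
  rw [h1]

theorem eLpNorm_two_sq {α E : Type*} [MeasurableSpace α] [NormedAddCommGroup E] {μ : Measure α}
    (f : α → E) : eLpNorm f 2 μ ^ 2 = ∫⁻ x, ‖f x‖ₑ ^ 2 ∂μ := by
  have h := eLpNorm_nnreal_pow_eq_lintegral (μ := μ) (f := f) (p := 2) (by norm_num)
  have e : ((2 : NNReal) : ℝ) = (2 : ℕ) := by norm_num
  simp only [e, ENNReal.rpow_natCast] at h
  simpa using h

theorem lintegral_fourier_toLp_sq {f : ℝ → ℂ} (hf : MemLp f 2) :
    ∫⁻ ξ, ‖(𝓕 (hf.toLp f) : Lp ℂ 2 (volume : Measure ℝ)) ξ‖ₑ ^ 2 = ∫⁻ x, ‖f x‖ₑ ^ 2 := by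
  rw [← eLpNorm_two_sq, ← eLpNorm_two_sq, ← Lp.enorm_def, ← eLpNorm_congr_ae hf.coeFn_toLp,
    ← Lp.enorm_def, ← ofReal_norm, ← ofReal_norm, Lp.norm_fourier_eq]

theorem Real.lintegral_fourier_sq {g : ℝ → ℂ} (hg : Integrable g) (hg2 : MemLp g 2) :
    ∫⁻ ξ, ‖𝓕 g ξ‖ₑ ^ 2 = ∫⁻ x, ‖g x‖ₑ ^ 2 := by
  rw [← lintegral_fourier_toLp_sq hg2]
  refine lintegral_congr_ae ?_
  filter_upwards [MemLp.coeFn_fourier_toLp hg hg2] with x h1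
  rw [h1]

theorem Real.memLp_fourier {g : ℝ → ℂ} (hg : Integrable g) (hg2 : MemLp g 2) :
    MemLp (𝓕 g) 2 :=
  (Lp.memLp (𝓕 (hg2.toLp g) : Lp ℂ 2 (volume : Measure ℝ))).ae_eq
    (MemLp.coeFn_fourier_toLp hg hg2)

/-- If the distributional Fourier support of `f ∈ L²` avoids `|ξ| < lam`, then the `L²` Fourier
transform of `f` vanishes there. -/
theorem fourier_toLp_ae_eq_zero {f : ℝ → ℂ} (hf : MemLp f 2 (volume : Measure ℝ)) {lam : ℝ}
    (hs : fourierSupport hf ⊆ {ξ | lam ≤ |ξ|}) :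
    ∀ᵐ ξ, |ξ| < lam → (𝓕 (hf.toLp f) : Lp ℂ 2 (volume : Measure ℝ)) ξ = 0 := by
  set F : Lp ℂ 2 (volume : Measure ℝ) := 𝓕 (hf.toLp f) with hF
  have hloc : ∀ x, |x| < lam → ∃ U ∈ nhds x, ∀ᵐ ξ, ξ ∈ U → F ξ = 0 := by
    intro x hx
    have hx' : x ∉ fourierSupport hf := fun h ↦ absurd (hs h) (not_le.mpr hx)
    rw [fourierSupport, Distribution.notMem_dsupport_iff,
      Lp.fourier_toTemperedDistribution_eq] at hx'
    obtain ⟨U, hU, hUo, hxU⟩ := hx'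
    refine ⟨U, hUo.mem_nhds hxU, hUo.ae_eq_zero_of_integral_contDiff_smul_eq_zero
      (((Lp.memLp F).locallyIntegrable (by norm_num)).locallyIntegrableOn U) fun φ hφ hc hsupp ↦ ?_⟩
    have hφ₁ : HasCompactSupport (Complex.ofRealCLM ∘ φ) := hc.comp_left rfl
    have hφ₂ : ContDiff ℝ ∞ (Complex.ofRealCLM ∘ φ) := by fun_prop
    have hsub : tsupport (Complex.ofRealCLM ∘ φ) ⊆ U :=
      (tsupport_comp_subset (map_zero Complex.ofRealCLM) φ).trans hsupp
    have h0 := hU (hφ₁.toSchwartzMap hφ₂) hsub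
    rw [Lp.toTemperedDistribution_apply] at h0
    simpa using h0
  have : volume ({ξ | |ξ| < lam} ∩ {ξ | F ξ ≠ 0}) = 0 := by
    refine measure_null_of_locally_null _ fun x hx ↦ ?_
    obtain ⟨U, hU, hz⟩ := hloc x hx.1
    refine ⟨U ∩ ({ξ | |ξ| < lam} ∩ {ξ | F ξ ≠ 0}), ?_, ?_⟩
    · exact Filter.inter_mem (mem_nhdsWithin_of_mem_nhds hU) self_mem_nhdsWithin
    · refine measure_mono_null ?_ (ae_iff.mp hz)
      intro ξ hξ
      simp only [Set.mem_ofPred_eq, Classical.not_imp]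
      exact ⟨hξ.1, hξ.2.2⟩
  rw [ae_iff]
  convert this using 2
  ext ξ
  simp

/-! ### Gaussian windows and the windowed Fourier transform -/

/-- The Gaussian window `exp (-π x²)`, which equals its own Fourier transform. -/
noncomputable def gaussWindow (x : ℝ) : ℝ := Real.exp (-Real.pi * x ^ 2)

theorem gaussWindow_pos (x : ℝ) : 0 < gaussWindow x := Real.exp_pos _

theorem gaussWindow_le_one (x : ℝ) : gaussWindow x ≤ 1 :=
  Real.exp_le_one_iff.mpr (by nlinarith [Real.pi_pos, sq_nonneg x])

@[fun_prop]
theorem continuous_gaussWindow : Continuous gaussWindow := by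
  unfold gaussWindow; fun_prop

theorem integrable_gaussWindow : Integrable gaussWindow :=
  integrable_exp_neg_mul_sq Real.pi_pos

theorem integral_gaussWindow : ∫ x, gaussWindow x = 1 := by
  unfold gaussWindow
  rw [integral_gaussian, div_self Real.pi_ne_zero, Real.sqrt_one]

theorem lintegral_gaussWindow : ∫⁻ x, ENNReal.ofReal (gaussWindow x) = 1 := by
  rw [← ofReal_integral_eq_lintegral_ofReal integrable_gaussWindow
    (Filter.Eventually.of_forall fun x ↦ (gaussWindow_pos x).le), integral_gaussWindow,
    ENNReal.ofReal_one]

theorem enorm_gaussWindow (x : ℝ) : ‖(gaussWindow x : ℂ)‖ₑ = ENNReal.ofReal (gaussWindow x) := by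
  rw [← ofReal_norm, Complex.norm_real, Real.norm_of_nonneg (gaussWindow_pos x).le]

theorem enorm_gaussWindow_le_one (x : ℝ) : ‖(gaussWindow x : ℂ)‖ₑ ≤ 1 := by
  rw [enorm_gaussWindow]
  exact ENNReal.ofReal_le_one.mpr (gaussWindow_le_one x)

theorem lintegral_gaussWindow_sq_le (s : ℝ) :
    ∫⁻ x, ‖(gaussWindow (x - s) : ℂ)‖ₑ ^ 2 ≤ 1 := by
  rw [lintegral_sub_right_eq_self (fun x ↦ ‖(gaussWindow x : ℂ)‖ₑ ^ 2) s,
    ← lintegral_gaussWindow]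
  refine lintegral_mono fun x ↦ ?_
  rw [← enorm_gaussWindow, sq]
  exact mul_le_of_le_one_left' (enorm_gaussWindow_le_one x)

theorem memLp_gaussWindow_one (s : ℝ) : MemLp (fun x ↦ (gaussWindow (x - s) : ℂ)) 1 :=
  memLp_one_iff_integrable.mpr (integrable_gaussWindow.comp_sub_right s).ofReal

theorem memLp_gaussWindow_top (s : ℝ) : MemLp (fun x ↦ (gaussWindow (x - s) : ℂ)) ∞ :=
  memLp_top_of_bound (by fun_prop) 1 (Filter.Eventually.of_forall fun x ↦ by
    rw [Complex.norm_real, Real.norm_of_nonneg (gaussWindow_pos _).le]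
    exact gaussWindow_le_one _)

theorem memLp_gaussWindow_two (s : ℝ) : MemLp (fun x ↦ (gaussWindow (x - s) : ℂ)) 2 := by
  refine ⟨by fun_prop, ?_⟩
  have h := eLpNorm_two_sq (μ := volume) (fun x ↦ (gaussWindow (x - s) : ℂ))
  by_contra hc
  rw [not_lt, top_le_iff] at hc
  rw [hc] at h
  have := lintegral_gaussWindow_sq_le s
  rw [← h] at this
  simp at this

/-- The localisation of `f` to the Gaussian window centred at `s`. -/
noncomputable def windowed (f : ℝ → ℂ) (s x : ℝ) : ℂ := f x * gaussWindow (x - s)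

theorem MeasureTheory.MemLp.windowed_integrable {f : ℝ → ℂ} (hf : MemLp f 2) (s : ℝ) :
    Integrable (windowed f s) :=
  memLp_one_iff_integrable.mp ((memLp_gaussWindow_two s).mul (p := 2) (q := 2) hf)

theorem MeasureTheory.MemLp.windowed_memLp {f : ℝ → ℂ} (hf : MemLp f 2) (s : ℝ) :
    MemLp (windowed f s) 2 :=
  (memLp_gaussWindow_top s).mul (p := 2) (q := ∞) hf

theorem MeasureTheory.MemLp.windowed_integrable_of_top {f : ℝ → ℂ} (hf : MemLp f ∞) (s : ℝ) :
    Integrable (windowed f s) :=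
  memLp_one_iff_integrable.mp ((memLp_gaussWindow_one s).mul (p := ∞) (q := 1) hf)

theorem MeasureTheory.MemLp.windowed_memLp_of_top {f : ℝ → ℂ} (hf : MemLp f ∞) (s : ℝ) :
    MemLp (windowed f s) 2 :=
  (memLp_gaussWindow_two s).mul (p := ∞) (q := 2) hf

/-- The time-frequency shift of the Gaussian window by `(s, ξ)`. -/
noncomputable def gaborAtom (s ξ x : ℝ) : ℂ :=
  gaussWindow (x - s) * Complex.exp (2 * Real.pi * ξ * x * Complex.I)

theorem norm_exp_two_pi_mul_I (t : ℝ) : ‖Complex.exp (2 * Real.pi * t * Complex.I)‖ = 1 := by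
  have : (2 * Real.pi * t * Complex.I : ℂ) = ((2 * Real.pi * t : ℝ) : ℂ) * Complex.I := by
    push_cast; ring
  rw [this, Complex.norm_exp_ofReal_mul_I]

theorem norm_gaborAtom (s ξ x : ℝ) : ‖gaborAtom s ξ x‖ = ‖(gaussWindow (x - s) : ℂ)‖ := by
  have := norm_exp_two_pi_mul_I (ξ * x)
  push_cast at this
  rw [gaborAtom, norm_mul, mul_assoc (2 * (Real.pi : ℂ)), this, mul_one]

theorem memLp_gaborAtom (s ξ : ℝ) : MemLp (gaborAtom s ξ) 2 := by
  refine (memLp_gaussWindow_two s).of_le ?_ (Filter.Eventually.of_forall fun x ↦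
    (norm_gaborAtom s ξ x).le)
  unfold gaborAtom
  fun_prop

theorem integrable_gaborAtom (s ξ : ℝ) : Integrable (gaborAtom s ξ) := by
  refine (memLp_one_iff_integrable.mp (memLp_gaussWindow_one s)).mono ?_
    (Filter.Eventually.of_forall fun x ↦ (norm_gaborAtom s ξ x).le)
  unfold gaborAtom
  fun_prop

theorem fourier_gaborAtom (s ξ η : ℝ) :
    𝓕 (gaborAtom s ξ) η =
      gaussWindow (η - ξ) * Complex.exp (2 * Real.pi * (s * (ξ - η)) * Complex.I) := by
  have h1 : gaborAtom s ξ = fun x : ℝ ↦ Complex.exp (-Real.pi * s ^ 2) •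
      Complex.exp (-Real.pi * 1 * x ^ 2 + 2 * Real.pi * (s + ξ * Complex.I) * x) := by
    ext x
    rw [gaborAtom, gaussWindow, Complex.ofReal_exp, smul_eq_mul, ← Complex.exp_add,
      ← Complex.exp_add]
    congr 1
    push_cast
    ring
  have h2 := congrFun (fourier_gaussian_pi' (b := 1) (by simp) (s + ξ * Complex.I)) η
  have h3 : 𝓕 (gaborAtom s ξ) η = Complex.exp (-Real.pi * s ^ 2) *
      𝓕 (fun x : ℝ ↦ Complex.exp (-Real.pi * 1 * x ^ 2 +
        2 * Real.pi * (s + ξ * Complex.I) * x)) η := by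
    rw [h1, Real.fourier_eq, Real.fourier_eq, ← integral_const_mul]
    refine integral_congr_ae (Filter.Eventually.of_forall fun x ↦ ?_)
    simp only [smul_eq_mul, Circle.smul_def]
    ring
  rw [h3, h2, gaussWindow, Complex.ofReal_exp, Complex.one_cpow, div_one, one_mul,
    ← Complex.exp_add, ← Complex.exp_add]
  congr 1
  push_cast
  linear_combination (-(Real.pi : ℂ) * s ^ 2 - Real.pi * ξ ^ 2 * (Complex.I ^ 2 - 1)
    - 2 * Real.pi * η * ξ - 2 * Real.pi * s * ξ * Complex.I) * Complex.I_sq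

/-- The windowed Fourier transform of `f` in terms of the `L²` Fourier transform of `f`: up to a
phase it is, as a function of the centre of the window, again a windowed Fourier transform. -/
theorem norm_fourier_windowed {f : ℝ → ℂ} (hf : MemLp f 2) (s ξ : ℝ) :
    ‖𝓕 (windowed f s) ξ‖ =
      ‖𝓕 (windowed (𝓕 (hf.toLp f) : Lp ℂ 2 (volume : Measure ℝ)) ξ) (-s)‖ := by
  have h1 : 𝓕 (windowed f s) ξ = ∫ x, f x * conj (gaborAtom s ξ x) := by
    rw [Real.fourier_real_eq_integral_exp_smul]
    refine integral_congr_ae (Filter.Eventually.of_forall fun x ↦ ?_)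
    simp only [windowed, gaborAtom, smul_eq_mul, map_mul, Complex.conj_ofReal,
      ← Complex.exp_conj, Complex.conj_I, map_ofNat]
    rw [mul_comm, ← mul_assoc]
    congr 2
    push_cast
    ring
  have h2 : 𝓕 (windowed f s) ξ = Complex.exp (-(2 * Real.pi * (s * ξ : ℝ) * Complex.I)) *
      𝓕 (windowed (𝓕 (hf.toLp f) : Lp ℂ 2 (volume : Measure ℝ)) ξ) (-s) := by
    rw [h1, hf.integral_mul_conj_eq_fourier_toLp (integrable_gaborAtom s ξ) (memLp_gaborAtom s ξ),
      Real.fourier_real_eq_integral_exp_smul, ← integral_const_mul]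
    refine integral_congr_ae (Filter.Eventually.of_forall fun η ↦ ?_)
    simp only [fourier_gaborAtom, windowed, smul_eq_mul, map_mul, Complex.conj_ofReal,
      ← Complex.exp_conj, Complex.conj_I, map_ofNat, map_sub]
    rw [← mul_assoc, ← mul_assoc (Complex.exp _) (Complex.exp _), ← Complex.exp_add, mul_comm]
    congr 2
    push_cast
    ring
  rw [h2, norm_mul, Complex.exp_neg, norm_inv, norm_exp_two_pi_mul_I, inv_one, one_mul]

theorem one_add_abs_mul_gaussWindow_le (t : ℝ) : (1 + |t|) * gaussWindow t ≤ 2 := by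
  have h := Real.add_one_le_exp (Real.pi * t ^ 2)
  have h1 : gaussWindow t * Real.exp (Real.pi * t ^ 2) = 1 := by
    rw [gaussWindow, ← Real.exp_add]; simp
  have h2 : 1 + |t| ≤ 2 * Real.exp (Real.pi * t ^ 2) := by
    nlinarith [Real.pi_gt_three, sq_abs t, sq_nonneg (|t| - 1), sq_nonneg t]
  nlinarith [gaussWindow_pos t]

/-- The weight `1 / (1 + |ξ|)` is essentially constant at the scale of the window. -/
theorem lintegral_weight_gaussWindow_sq_le (η : ℝ) :
    ∫⁻ ξ, ENNReal.ofReal (1 + |ξ|)⁻¹ * ‖(gaussWindow (η - ξ) : ℂ)‖ₑ ^ 2 ≤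
      2 * ENNReal.ofReal (1 + |η|)⁻¹ := by
  calc ∫⁻ ξ, ENNReal.ofReal (1 + |ξ|)⁻¹ * ‖(gaussWindow (η - ξ) : ℂ)‖ₑ ^ 2
      ≤ ∫⁻ ξ, ENNReal.ofReal (2 * (1 + |η|)⁻¹) * ENNReal.ofReal (gaussWindow (η - ξ)) := by
        refine lintegral_mono fun ξ ↦ ?_
        rw [enorm_gaussWindow, ← ENNReal.ofReal_pow (gaussWindow_pos _).le,
          ← ENNReal.ofReal_mul (by positivity), ← ENNReal.ofReal_mul (by positivity)]
        refine ENNReal.ofReal_le_ofReal ?_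
        have h1 := one_add_abs_mul_gaussWindow_le (η - ξ)
        have h2 : 1 + |η| ≤ (1 + |ξ|) * (1 + |η - ξ|) := by
          have : |η| ≤ |ξ| + |η - ξ| := by
            simpa using abs_add_le ξ (η - ξ)
          nlinarith [abs_nonneg ξ, abs_nonneg (η - ξ)]
        have h3 := gaussWindow_pos (η - ξ)
        have h4 : (1 + |η|) * gaussWindow (η - ξ) ≤ 2 * (1 + |ξ|) :=
          calc (1 + |η|) * gaussWindow (η - ξ)
              ≤ (1 + |ξ|) * (1 + |η - ξ|) * gaussWindow (η - ξ) := by gcongr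
            _ = (1 + |ξ|) * ((1 + |η - ξ|) * gaussWindow (η - ξ)) := by ring
            _ ≤ (1 + |ξ|) * 2 := by gcongr
            _ = _ := by ring
        have h5 : (1 + |ξ|)⁻¹ * gaussWindow (η - ξ) ≤ 2 * (1 + |η|)⁻¹ := by
          rw [inv_mul_eq_div, ← div_eq_mul_inv, div_le_div_iff₀ (by positivity) (by positivity)]
          linarith
        rw [sq, ← mul_assoc]
        gcongr
    _ = _ := by
        rw [lintegral_const_mul _ (by fun_prop),
          lintegral_sub_left_eq_self (fun x ↦ ENNReal.ofReal (gaussWindow x)) η,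
          lintegral_gaussWindow, mul_one, ENNReal.ofReal_mul (by norm_num), ENNReal.ofReal_ofNat]

theorem measurable_fourier_windowed {f : ℝ → ℂ} (hf : Measurable f) :
    Measurable (fun p : ℝ × ℝ ↦ 𝓕 (windowed f p.1) p.2) := by
  simp only [Real.fourier_real_eq_integral_exp_smul, windowed]
  have : StronglyMeasurable (Function.uncurry fun (p : ℝ × ℝ) (x : ℝ) ↦
      Complex.exp (↑(-2 * Real.pi * x * p.2) * Complex.I) •
        (f x * (gaussWindow (x - p.1) : ℂ))) := by
    refine Measurable.stronglyMeasurable ?_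
    unfold Function.uncurry
    have := continuous_gaussWindow.measurable
    fun_prop
  exact (this.integral_prod_right (ν := volume)).measurable

/-- High-frequency functions stay of high frequency, in the `H^{-1/2}` sense and on average, after
localisation to Gaussian windows. -/
theorem lintegral_fourier_windowed_le {f : ℝ → ℂ} (hf : MemLp f 2) {lam : ℝ} (hlam : 0 < lam)
    (hF : ∀ᵐ ξ, |ξ| < lam → (𝓕 (hf.toLp f) : Lp ℂ 2 (volume : Measure ℝ)) ξ = 0) :
    ∫⁻ s, ∫⁻ ξ, ENNReal.ofReal (1 + |ξ|)⁻¹ * ‖𝓕 (windowed f s) ξ‖ₑ ^ 2 ≤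
      2 * ENNReal.ofReal lam⁻¹ * ∫⁻ x, ‖f x‖ₑ ^ 2 := by
  set F : Lp ℂ 2 (volume : Measure ℝ) := 𝓕 (hf.toLp f) with hFdef
  have hFm : Measurable F := (Lp.stronglyMeasurable F).measurable
  have hF2 : MemLp F 2 := Lp.memLp F
  have hg := continuous_gaussWindow.measurable
  calc ∫⁻ s, ∫⁻ ξ, ENNReal.ofReal (1 + |ξ|)⁻¹ * ‖𝓕 (windowed f s) ξ‖ₑ ^ 2
      = ∫⁻ s, ∫⁻ ξ, ENNReal.ofReal (1 + |ξ|)⁻¹ * ‖𝓕 (windowed F ξ) (-s)‖ₑ ^ 2 := by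
        refine lintegral_congr fun s ↦ lintegral_congr fun ξ ↦ ?_
        rw [← ofReal_norm, norm_fourier_windowed hf, ofReal_norm]
    _ = ∫⁻ ξ, ∫⁻ s, ENNReal.ofReal (1 + |ξ|)⁻¹ * ‖𝓕 (windowed F ξ) (-s)‖ₑ ^ 2 := by
        refine lintegral_lintegral_swap (Measurable.aemeasurable ?_)
        have h := (measurable_fourier_windowed hFm).comp
          (measurable_snd.prodMk measurable_fst.neg : Measurable fun p : ℝ × ℝ ↦ (p.2, -p.1))
        simp only [Function.comp_def] at h
        unfold Function.uncurry
        fun_prop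
    _ = ∫⁻ ξ, ∫⁻ η, ENNReal.ofReal (1 + |ξ|)⁻¹ *
          (‖F η‖ₑ ^ 2 * ‖(gaussWindow (η - ξ) : ℂ)‖ₑ ^ 2) := by
        refine lintegral_congr fun ξ ↦ ?_
        rw [lintegral_const_mul' _ _ ENNReal.ofReal_ne_top,
          lintegral_const_mul' _ _ ENNReal.ofReal_ne_top,
          lintegral_neg_eq_self (fun s ↦ ‖𝓕 (windowed F ξ) s‖ₑ ^ 2),
          Real.lintegral_fourier_sq (hF2.windowed_integrable ξ) (hF2.windowed_memLp ξ)]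
        congr 1
        refine lintegral_congr fun η ↦ ?_
        rw [windowed, enorm_mul, mul_pow]
    _ = ∫⁻ η, ‖F η‖ₑ ^ 2 *
          ∫⁻ ξ, ENNReal.ofReal (1 + |ξ|)⁻¹ * ‖(gaussWindow (η - ξ) : ℂ)‖ₑ ^ 2 := by
        rw [lintegral_lintegral_swap (Measurable.aemeasurable (by unfold Function.uncurry; fun_prop))]
        refine lintegral_congr fun η ↦ ?_
        rw [← lintegral_const_mul _ (by fun_prop)]
        refine lintegral_congr fun ξ ↦ ?_
        ring
    _ ≤ ∫⁻ η, ‖F η‖ₑ ^ 2 * (2 * ENNReal.ofReal lam⁻¹) := by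
        refine lintegral_mono_ae ?_
        filter_upwards [hF] with η hη
        by_cases h : |η| < lam
        · simp [hη h]
        · gcongr
          refine (lintegral_weight_gaussWindow_sq_le η).trans ?_
          gcongr
          linarith [not_lt.mp h]
    _ = _ := by
        rw [lintegral_mul_const _ (by fun_prop), lintegral_fourier_toLp_sq hf, mul_comm]

/-! ### A trilinear form with fixed directions, on the Fourier side -/

theorem ENNReal.sq_lintegral_mul_le {α : Type*} [MeasurableSpace α] {μ : Measure α}
    {f g : α → ℝ≥0∞} (hf : AEMeasurable f μ) (hg : AEMeasurable g μ) :
    (∫⁻ a, f a * g a ∂μ) ^ 2 ≤ (∫⁻ a, f a ^ 2 ∂μ) * ∫⁻ a, g a ^ 2 ∂μ := by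
  have h := ENNReal.lintegral_mul_le_Lp_mul_Lq μ Real.HolderConjugate.two_two hf hg
  calc (∫⁻ a, f a * g a ∂μ) ^ 2
      ≤ ((∫⁻ a, f a ^ (2 : ℝ) ∂μ) ^ (1 / 2 : ℝ) * (∫⁻ a, g a ^ (2 : ℝ) ∂μ) ^ (1 / 2 : ℝ)) ^ 2 := by
        gcongr; exact h
    _ = _ := by
        have e : ∀ x : ℝ≥0∞, (x ^ (1 / 2 : ℝ)) ^ 2 = x := fun x ↦ by
          rw [← ENNReal.rpow_natCast, ← ENNReal.rpow_mul]; norm_num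
        rw [mul_pow, e, e]
        norm_cast

theorem lintegral_comp_mul_add (G : ℝ → ℝ≥0∞) {c : ℝ} (hc : c ≠ 0) (d : ℝ) :
    ∫⁻ r, G (c * r + d) = ENNReal.ofReal |c⁻¹| * ∫⁻ x, G x := by
  rw [← lintegral_add_right_eq_self G d, ← smul_eq_mul, ← lintegral_smul_measure,
    ← Real.map_volume_mul_left hc]
  exact ((MeasurableEquiv.mulLeft₀ c hc).measurableEmbedding.lintegral_map
    (fun x ↦ G (x + d))).symm

/-- The character `t ↦ exp (2πi t)` with values in `ℂ`. -/
noncomputable def unitChar (t : ℝ) : ℂ := Complex.exp (2 * Real.pi * t * Complex.I)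

@[simp]
theorem norm_unitChar (t : ℝ) : ‖unitChar t‖ = 1 := norm_exp_two_pi_mul_I t

theorem unitChar_add (s t : ℝ) : unitChar (s + t) = unitChar s * unitChar t := by
  rw [unitChar, unitChar, unitChar, ← Complex.exp_add]
  congr 1
  push_cast
  ring

theorem conj_unitChar (t : ℝ) : conj (unitChar t) = unitChar (-t) := by
  simp [unitChar, ← Complex.exp_conj, map_ofNat]

@[fun_prop]
theorem continuous_unitChar : Continuous unitChar := by
  unfold unitChar
  fun_prop

theorem Real.fourier_eq_integral_unitChar_mul (f : ℝ → ℂ) (w : ℝ) :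
    𝓕 f w = ∫ v, unitChar (-(v * w)) * f v := by
  rw [Real.fourier_real_eq_integral_exp_smul]
  refine integral_congr_ae (Filter.Eventually.of_forall fun x ↦ ?_)
  simp only [smul_eq_mul, unitChar]
  congr 2
  push_cast
  ring

theorem Real.fourier_comp_sub (g : ℝ → ℂ) (c ξ : ℝ) :
    𝓕 (fun x ↦ g (x - c)) ξ = unitChar (-(c * ξ)) * 𝓕 g ξ := by
  rw [Real.fourier_eq_integral_unitChar_mul, Real.fourier_eq_integral_unitChar_mul,
    ← integral_const_mul, ← integral_sub_right_eq_self
      (fun x ↦ unitChar (-(c * ξ)) * (unitChar (-(x * ξ)) * g x)) c]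
  refine integral_congr_ae (Filter.Eventually.of_forall fun x ↦ ?_)
  simp only
  rw [← mul_assoc, ← unitChar_add]
  congr 3
  ring

theorem Real.fourier_conj_mul_unitChar (g : ℝ → ℂ) (k ξ : ℝ) :
    𝓕 (fun x ↦ conj (g x) * unitChar (x * k)) ξ = conj (𝓕 g (k - ξ)) := by
  rw [Real.fourier_eq_integral_unitChar_mul, Real.fourier_eq_integral_unitChar_mul,
    ← integral_conj]
  refine integral_congr_ae (Filter.Eventually.of_forall fun x ↦ ?_)
  simp only [map_mul, conj_unitChar]
  rw [mul_comm (conj (g x)), ← mul_assoc, ← unitChar_add]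
  congr 3
  ring

/-- The Fourier transform of a product of translates. -/
theorem integral_unitChar_mul_translates {g₁ g₂ : ℝ → ℂ} (h₁ : Integrable g₁) (h₁' : MemLp g₁ 2)
    (h₂ : Integrable g₂) (h₂' : MemLp g₂ 2) (c d k : ℝ) :
    ∫ x, unitChar (-(x * k)) * (g₁ (x - c) * g₂ (x - d)) =
      ∫ ξ, unitChar (-(c * ξ + d * (k - ξ))) * (𝓕 g₁ ξ * 𝓕 g₂ (k - ξ)) := by
  have hn : ∀ x, ‖conj (g₂ (x - d)) * unitChar (x * k)‖ = ‖g₂ (x - d)‖ := by simp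
  have hm : AEStronglyMeasurable
      (fun x ↦ conj (g₂ (x - d)) * unitChar (x * k)) volume := by
    refine AEStronglyMeasurable.mul ?_ (by fun_prop)
    exact (Complex.continuous_conj.comp_aestronglyMeasurable (h₂.comp_sub_right d).1)
  have p1 := Real.integral_mul_conj_eq_integral_fourier (h₁.comp_sub_right c)
    (h₁'.comp_measurePreserving (measurePreserving_sub_right volume c))
    (((h₂.comp_sub_right d).norm.mono' hm (Filter.Eventually.of_forall fun x ↦ (hn x).le)))
    ((h₂'.comp_measurePreserving (measurePreserving_sub_right volume d)).of_le hm
      (Filter.Eventually.of_forall fun x ↦ (hn x).le))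
  calc _ = ∫ x, g₁ (x - c) * conj (conj (g₂ (x - d)) * unitChar (x * k)) := by
        refine integral_congr_ae (Filter.Eventually.of_forall fun x ↦ ?_)
        simp only [map_mul, Complex.conj_conj, conj_unitChar]
        ring
    _ = _ := p1
    _ = _ := by
        refine integral_congr_ae (Filter.Eventually.of_forall fun ξ ↦ ?_)
        simp only
        have e : (fun x ↦ g₁ (x - c)) = g₁ ∘ fun x ↦ x - c := rfl
        rw [Real.fourier_conj_mul_unitChar (fun x ↦ g₂ (x - d)), Real.fourier_comp_sub,
          Complex.conj_conj, Real.fourier_comp_sub, neg_add, unitChar_add]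
        ring

/-- As `a ≠ b`, the map `(r, x) ↦ (x - r a, x - r b)` is a linear change of variables. -/
theorem lintegral_translates_mul {G₁ G₂ : ℝ → ℝ≥0∞} (h₁ : Measurable G₁) (h₂ : Measurable G₂)
    {a b : ℝ} (hab : a ≠ b) :
    ∫⁻ p : ℝ × ℝ, G₁ (p.2 - p.1 * a) * G₂ (p.2 - p.1 * b) =
      ENNReal.ofReal |(a - b)⁻¹| * ((∫⁻ x, G₁ x) * ∫⁻ x, G₂ x) := by
  rw [Measure.volume_eq_prod, lintegral_prod _ (by fun_prop)]
  calc ∫⁻ r, ∫⁻ x, G₁ (x - r * a) * G₂ (x - r * b)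
      = ∫⁻ r, ∫⁻ x, G₁ x * G₂ ((a - b) * r + x) := by
        refine lintegral_congr fun r ↦ ?_
        rw [← lintegral_sub_right_eq_self (fun x ↦ G₁ x * G₂ ((a - b) * r + x)) (r * a)]
        refine lintegral_congr fun x ↦ ?_
        congr 2
        ring
    _ = ∫⁻ x, ∫⁻ r, G₁ x * G₂ ((a - b) * r + x) :=
        lintegral_lintegral_swap (by unfold Function.uncurry; fun_prop)
    _ = ∫⁻ x, G₁ x * (ENNReal.ofReal |(a - b)⁻¹| * ∫⁻ x, G₂ x) := by
        refine lintegral_congr fun x ↦ ?_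
        rw [lintegral_const_mul _ (by fun_prop), lintegral_comp_mul_add _ (sub_ne_zero.mpr hab)]
    _ = _ := by rw [lintegral_mul_const _ h₁]; ring

theorem MeasureTheory.MemLp.lintegral_sq_lt_top {α : Type*} [MeasurableSpace α] {μ : Measure α}
    {f : α → ℂ} (hf : MemLp f 2 μ) : ∫⁻ x, ‖f x‖ₑ ^ 2 ∂μ < ⊤ := by
  rw [← eLpNorm_two_sq]
  exact ENNReal.pow_lt_top hf.2

theorem memLp_two_of_lintegral_sq {α : Type*} [MeasurableSpace α] {μ : Measure α}
    {f : α → ℂ} (hm : AEStronglyMeasurable f μ) (hf : ∫⁻ x, ‖f x‖ₑ ^ 2 ∂μ < ⊤) :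
    MemLp f 2 μ := by
  refine ⟨hm, ?_⟩
  rw [← eLpNorm_two_sq] at hf
  by_contra hc
  rw [not_lt, top_le_iff] at hc
  rw [hc] at hf
  simp at hf

section Directions

variable {g₁ g₂ g₃ w : ℝ → ℂ} {a b : ℝ}

theorem memLp_translates_mul (m₁ : Measurable g₁) (m₂ : Measurable g₂) (h₁ : MemLp g₁ 2)
    (h₂ : MemLp g₂ 2) (hab : a ≠ b) :
    MemLp (fun p : ℝ × ℝ ↦ g₁ (p.2 - p.1 * a) * g₂ (p.2 - p.1 * b)) 2 := by
  refine memLp_two_of_lintegral_sq (by fun_prop) ?_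
  have := lintegral_translates_mul (m₁.enorm.pow_const 2) (m₂.enorm.pow_const 2) hab
  simp only [enorm_mul, mul_pow]
  rw [this]
  exact ENNReal.mul_lt_top ENNReal.ofReal_lt_top
    (ENNReal.mul_lt_top h₁.lintegral_sq_lt_top h₂.lintegral_sq_lt_top)

theorem integrable_directional_form (m₁ : Measurable g₁) (m₂ : Measurable g₂)
    (m₃ : Measurable g₃) (mw : Measurable w) (h₁ : MemLp g₁ 2)
    (h₂ : MemLp g₂ 2) (h₃ : MemLp g₃ 2) (hw : MemLp w 2) (hab : a ≠ b) :
    Integrable (fun p : ℝ × ℝ ↦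
      w p.1 * g₁ (p.2 - p.1 * a) * g₂ (p.2 - p.1 * b) * conj (g₃ p.2)) := by
  have hQ : MemLp (fun p : ℝ × ℝ ↦ w p.1 * conj (g₃ p.2)) 2 := by
    have mc := Complex.continuous_conj.measurable
    refine memLp_two_of_lintegral_sq (by fun_prop) ?_
    simp only [enorm_mul, mul_pow, RCLike.enorm_conj]
    rw [Measure.volume_eq_prod, lintegral_prod_mul (f := fun x ↦ ‖w x‖ₑ ^ 2)
      (g := fun x ↦ ‖g₃ x‖ₑ ^ 2) (by fun_prop) (by fun_prop)]
    exact ENNReal.mul_lt_top hw.lintegral_sq_lt_top h₃.lintegral_sq_lt_top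
  refine ((memLp_translates_mul m₁ m₂ h₁ h₂ hab).integrable_mul hQ).congr
    (Filter.Eventually.of_forall fun p ↦ ?_)
  simp only [Pi.mul_apply]
  ring

theorem integrable_directional_mul (m₁ : Measurable g₁) (m₂ : Measurable g₂)
    (mw : Measurable w) (h₁ : MemLp g₁ 2) (h₂ : MemLp g₂ 2) (hw : Integrable w) :
    Integrable (fun p : ℝ × ℝ ↦ w p.1 * (g₁ (p.2 - p.1 * a) * g₂ (p.2 - p.1 * b))) := by
  refine ⟨by fun_prop, ?_⟩
  rw [hasFiniteIntegral_iff_enorm, Measure.volume_eq_prod, lintegral_prod _ (by fun_prop)]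
  set N := (∫⁻ x, ‖g₁ x‖ₑ ^ 2) * ∫⁻ x, ‖g₂ x‖ₑ ^ 2 with hN
  have hNt : N < ⊤ := ENNReal.mul_lt_top h₁.lintegral_sq_lt_top h₂.lintegral_sq_lt_top
  have hr : ∀ r : ℝ, ∫⁻ x, ‖g₁ (x - r * a)‖ₑ * ‖g₂ (x - r * b)‖ₑ ≤ N ^ (1 / 2 : ℝ) := by
    intro r
    have := ENNReal.sq_lintegral_mul_le (μ := volume) (f := fun x ↦ ‖g₁ (x - r * a)‖ₑ)
      (g := fun x ↦ ‖g₂ (x - r * b)‖ₑ) (by fun_prop) (by fun_prop)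
    rw [lintegral_sub_right_eq_self (fun x ↦ ‖g₁ x‖ₑ ^ 2),
      lintegral_sub_right_eq_self (fun x ↦ ‖g₂ x‖ₑ ^ 2)] at this
    rw [one_div]
    refine ENNReal.le_rpow_inv_iff (by norm_num) |>.mpr ?_
    exact_mod_cast this
  calc ∫⁻ r, ∫⁻ x, ‖w r * (g₁ (x - r * a) * g₂ (x - r * b))‖ₑ
      = ∫⁻ r, ‖w r‖ₑ * ∫⁻ x, ‖g₁ (x - r * a)‖ₑ * ‖g₂ (x - r * b)‖ₑ := by
        refine lintegral_congr fun r ↦ ?_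
        rw [← lintegral_const_mul _ (by fun_prop)]
        simp only [enorm_mul]
    _ ≤ ∫⁻ r, ‖w r‖ₑ * N ^ (1 / 2 : ℝ) := by gcongr with r; exact hr r
    _ = (∫⁻ r, ‖w r‖ₑ) * N ^ (1 / 2 : ℝ) := lintegral_mul_const _ (by fun_prop)
    _ < ⊤ := ENNReal.mul_lt_top (hasFiniteIntegral_iff_enorm.mp hw.2)
        (ENNReal.rpow_lt_top_of_nonneg (by norm_num) hNt.ne)

/-- The bilinear average of `g₁`, `g₂` in the directions `a`, `b`. -/
noncomputable def directionalMean (w g₁ g₂ : ℝ → ℂ) (a b x : ℝ) : ℂ :=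
  ∫ r, w r * (g₁ (x - r * a) * g₂ (x - r * b))

theorem integrable_directionalMean (m₁ : Measurable g₁) (m₂ : Measurable g₂)
    (mw : Measurable w) (h₁ : MemLp g₁ 2) (h₂ : MemLp g₂ 2) (hw : Integrable w) :
    Integrable (directionalMean w g₁ g₂ a b) :=
  (integrable_directional_mul m₁ m₂ mw h₁ h₂ hw).integral_prod_right

theorem memLp_directionalMean (m₁ : Measurable g₁) (m₂ : Measurable g₂)
    (mw : Measurable w) (h₁ : MemLp g₁ 2) (h₂ : MemLp g₂ 2) (hw : Integrable w)
    (hw2 : MemLp w 2) (hab : a ≠ b) :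
    MemLp (directionalMean w g₁ g₂ a b) 2 := by
  refine memLp_two_of_lintegral_sq (integrable_directionalMean m₁ m₂ mw h₁ h₂ hw).1 ?_
  calc ∫⁻ x, ‖directionalMean w g₁ g₂ a b x‖ₑ ^ 2
      ≤ ∫⁻ x, (∫⁻ r, ‖w r‖ₑ * ‖g₁ (x - r * a) * g₂ (x - r * b)‖ₑ) ^ 2 := by
        refine lintegral_mono fun x ↦ ?_
        gcongr
        refine (enorm_integral_le_lintegral_enorm _).trans_eq ?_
        simp only [enorm_mul]
    _ ≤ ∫⁻ x, (∫⁻ r, ‖w r‖ₑ ^ 2) * ∫⁻ r, ‖g₁ (x - r * a) * g₂ (x - r * b)‖ₑ ^ 2 := by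
        refine lintegral_mono fun x ↦ ?_
        exact ENNReal.sq_lintegral_mul_le (by fun_prop) (by fun_prop)
    _ = (∫⁻ r, ‖w r‖ₑ ^ 2) *
          ∫⁻ p : ℝ × ℝ, ‖g₁ (p.2 - p.1 * a) * g₂ (p.2 - p.1 * b)‖ₑ ^ 2 := by
        rw [lintegral_const_mul' _ _ hw2.lintegral_sq_lt_top.ne, Measure.volume_eq_prod,
          lintegral_prod_symm _ (by fun_prop)]
    _ < ⊤ := ENNReal.mul_lt_top hw2.lintegral_sq_lt_top
        (memLp_translates_mul m₁ m₂ h₁ h₂ hab).lintegral_sq_lt_top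

theorem fourier_directionalMean (m₁ : Measurable g₁) (m₂ : Measurable g₂)
    (mw : Measurable w) (i₁ : Integrable g₁) (h₁ : MemLp g₁ 2) (i₂ : Integrable g₂)
    (h₂ : MemLp g₂ 2) (hw : Integrable w) (k : ℝ) :
    𝓕 (directionalMean w g₁ g₂ a b) k =
      ∫ ξ, 𝓕 g₁ ξ * 𝓕 g₂ (k - ξ) * 𝓕 w (a * ξ + b * (k - ξ)) := by
  have hprod : Integrable (fun ξ ↦ 𝓕 g₁ ξ * 𝓕 g₂ (k - ξ)) :=
    (Real.memLp_fourier i₁ h₁).integrable_mul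
      ((Real.memLp_fourier i₂ h₂).comp_measurePreserving (Measure.measurePreserving_sub_left volume k))
  calc 𝓕 (directionalMean w g₁ g₂ a b) k
      = ∫ x, ∫ r, w r * (unitChar (-(x * k)) *
          (g₁ (x - r * a) * g₂ (x - r * b))) := by
        rw [Real.fourier_eq_integral_unitChar_mul]
        refine integral_congr_ae (Filter.Eventually.of_forall fun x ↦ ?_)
        simp only [directionalMean]
        rw [← integral_const_mul]
        refine integral_congr_ae (Filter.Eventually.of_forall fun r ↦ ?_)
        simp only
        ring
    _ = ∫ r, ∫ x, w r * (unitChar (-(x * k)) *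
          (g₁ (x - r * a) * g₂ (x - r * b))) := by
        refine integral_integral_swap ?_
        have := (integrable_directional_mul (a := a) (b := b) m₁ m₂ mw h₁ h₂ hw).swap
        have mu := continuous_unitChar.measurable
        refine this.mono (Measurable.aestronglyMeasurable (by unfold Function.uncurry; fun_prop))
          (Filter.Eventually.of_forall fun p ↦ ?_)
        simp [Function.uncurry]
    _ = ∫ r, ∫ ξ, w r * (unitChar (-(r * (a * ξ + b * (k - ξ)))) *
          (𝓕 g₁ ξ * 𝓕 g₂ (k - ξ))) := by
        refine integral_congr_ae (Filter.Eventually.of_forall fun r ↦ ?_)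
        simp only
        rw [integral_const_mul, integral_unitChar_mul_translates i₁ h₁ i₂ h₂,
          ← integral_const_mul]
        refine integral_congr_ae (Filter.Eventually.of_forall fun ξ ↦ ?_)
        simp only
        congr 4
        ring
    _ = ∫ ξ, ∫ r, w r * (unitChar (-(r * (a * ξ + b * (k - ξ)))) *
          (𝓕 g₁ ξ * 𝓕 g₂ (k - ξ))) := by
        refine integral_integral_swap ?_
        have c₁ := Real.continuous_fourier_of_integrable i₁
        have c₂ := Real.continuous_fourier_of_integrable i₂
        refine (hw.mul_prod hprod).mono ?_ (Filter.Eventually.of_forall fun p ↦ ?_)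
        · refine Measurable.aestronglyMeasurable ?_
          unfold Function.uncurry
          have := c₁.measurable
          have := c₂.measurable
          fun_prop
        · simp [Function.uncurry]
    _ = _ := by
        refine integral_congr_ae (Filter.Eventually.of_forall fun ξ ↦ ?_)
        simp only
        rw [Real.fourier_eq_integral_unitChar_mul w, ← integral_const_mul]
        refine integral_congr_ae (Filter.Eventually.of_forall fun r ↦ ?_)
        simp only
        ring

/-- The trilinear form with directions `a ≠ b` and radial weight `w` is dominated by its
representation on the Fourier side. -/
theorem enorm_directional_form_le (m₁ : Measurable g₁) (m₂ : Measurable g₂)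
    (m₃ : Measurable g₃) (mw : Measurable w) (i₁ : Integrable g₁) (h₁ : MemLp g₁ 2)
    (i₂ : Integrable g₂) (h₂ : MemLp g₂ 2) (i₃ : Integrable g₃) (h₃ : MemLp g₃ 2)
    (hw : Integrable w) (hw2 : MemLp w 2) (hab : a ≠ b) :
    ‖∫ r, ∫ x, w r * g₁ (x - r * a) * g₂ (x - r * b) * conj (g₃ x)‖ₑ ≤
      ∫⁻ k, ∫⁻ ξ, ‖𝓕 g₁ ξ‖ₑ * ‖𝓕 g₂ (k - ξ)‖ₑ * ‖𝓕 w (a * ξ + b * (k - ξ))‖ₑ * ‖𝓕 g₃ k‖ₑ := by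
  have e : ∫ r, ∫ x, w r * g₁ (x - r * a) * g₂ (x - r * b) * conj (g₃ x) =
      ∫ k, 𝓕 (directionalMean w g₁ g₂ a b) k * conj (𝓕 g₃ k) := by
    rw [integral_integral_swap (integrable_directional_form m₁ m₂ m₃ mw h₁ h₂ h₃ hw2 hab),
      ← Real.integral_mul_conj_eq_integral_fourier
        (integrable_directionalMean m₁ m₂ mw h₁ h₂ hw)
        (memLp_directionalMean m₁ m₂ mw h₁ h₂ hw hw2 hab) i₃ h₃]
    refine integral_congr_ae (Filter.Eventually.of_forall fun x ↦ ?_)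
    simp only [directionalMean]
    rw [← integral_mul_const]
    simp only [mul_assoc]
  rw [e]
  refine (enorm_integral_le_lintegral_enorm _).trans (lintegral_mono fun k ↦ ?_)
  rw [enorm_mul, RCLike.enorm_conj, fourier_directionalMean m₁ m₂ mw i₁ h₁ i₂ h₂ hw,
    lintegral_mul_const' _ _ enorm_ne_top]
  gcongr
  refine (enorm_integral_le_lintegral_enorm _).trans_eq ?_
  simp only [enorm_mul]

end Directions

/-! ### Polar coordinates and estimates on the circle -/

theorem finrank_plane : Module.finrank ℝ Plane = 2 := by simp

instance : IsFiniteMeasure arcLength := by unfold arcLength; infer_instance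

theorem lintegral_volumeIoiPow_one (G : ℝ → ℝ≥0∞) (hG : Measurable G) :
    ∫⁻ r : Set.Ioi (0 : ℝ), G r ∂(Measure.volumeIoiPow 1) =
      ∫⁻ r in Set.Ioi (0 : ℝ), ENNReal.ofReal r * G r := by
  rw [Measure.volumeIoiPow, lintegral_withDensity_eq_lintegral_mul _ (by fun_prop) (by fun_prop),
    ← lintegral_subtype_comap measurableSet_Ioi]
  simp

theorem measurePreserving_polar : MeasurePreserving (homeomorphUnitSphereProd Plane)
    ((volume : Measure Plane).comap (↑)) (arcLength.prod (Measure.volumeIoiPow 1)) := by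
  have := (volume : Measure Plane).measurePreserving_homeomorphUnitSphereProd
  rwa [finrank_plane] at this

theorem homeomorphUnitSphereProd_smul (y : ({0}ᶜ : Set Plane)) :
    ((homeomorphUnitSphereProd Plane y).2 : ℝ) • ((homeomorphUnitSphereProd Plane y).1 : Plane) =
      y := by
  have := congrArg Subtype.val ((homeomorphUnitSphereProd Plane).symm_apply_apply y)
  rwa [homeomorphUnitSphereProd_symm_apply_coe] at this

theorem lintegral_polar {H : Plane → ℝ≥0∞} (hH : Measurable H) :
    ∫⁻ y, H y = ∫⁻ θ, ∫⁻ r in Set.Ioi (0 : ℝ), ENNReal.ofReal r * H (r • (θ : Plane))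
      ∂volume ∂arcLength := by
  calc ∫⁻ y, H y = ∫⁻ y : ({0}ᶜ : Set Plane), H y ∂((volume : Measure Plane).comap (↑)) := by
        rw [lintegral_subtype_comap (measurableSet_singleton _).compl, restrict_compl_singleton]
    _ = ∫⁻ p, H ((p.2 : ℝ) • (p.1 : Plane)) ∂(arcLength.prod (Measure.volumeIoiPow 1)) := by
        rw [← measurePreserving_polar.lintegral_comp_emb
          (homeomorphUnitSphereProd Plane).measurableEmbedding]
        simp only [homeomorphUnitSphereProd_smul]
    _ = _ := by
        rw [lintegral_prod _ (by fun_prop)]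
        refine lintegral_congr fun θ ↦ ?_
        exact lintegral_volumeIoiPow_one (fun r ↦ H (r • (θ : Plane))) (by fun_prop)

theorem enorm_integral_le_polar (H : Plane → ℂ) :
    ‖∫ y, H y‖ₑ ≤ ∫⁻ θ, ‖∫ r in Set.Ioi (0 : ℝ), (r : ℂ) * H (r • (θ : Plane))‖ₑ ∂arcLength := by
  by_cases hH : Integrable H
  swap
  · simp [integral_undef hH]
  have e1 : ∫ y, H y = ∫ y : ({0}ᶜ : Set Plane), H y ∂((volume : Measure Plane).comap (↑)) := by
    rw [integral_subtype_comap (measurableSet_singleton _).compl, restrict_compl_singleton]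
  have e2 : (fun y : ({0}ᶜ : Set Plane) ↦ H y) =
      (fun p : UnitCircle × Set.Ioi (0 : ℝ) ↦ H ((p.2 : ℝ) • (p.1 : Plane))) ∘
        homeomorphUnitSphereProd Plane := by
    ext y
    simp only [Function.comp_apply, homeomorphUnitSphereProd_smul]
  have hi : Integrable (fun p : UnitCircle × Set.Ioi (0 : ℝ) ↦ H ((p.2 : ℝ) • (p.1 : Plane)))
      (arcLength.prod (Measure.volumeIoiPow 1)) := by
    rw [← measurePreserving_polar.integrable_comp_emb
      (homeomorphUnitSphereProd Plane).measurableEmbedding, ← e2]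
    have := hH.integrableOn (s := {0}ᶜ)
    rwa [integrableOn_iff_comap_subtypeVal (measurableSet_singleton _).compl] at this
  have e3 : ∫ y, H y = ∫ θ, ∫ r : Set.Ioi (0 : ℝ), H ((r : ℝ) • (θ : Plane))
      ∂(Measure.volumeIoiPow 1) ∂arcLength := by
    rw [← integral_prod (fun p : UnitCircle × Set.Ioi (0 : ℝ) ↦ H ((p.2 : ℝ) • (p.1 : Plane))) hi,
      e1, ← measurePreserving_polar.integral_comp
        (homeomorphUnitSphereProd Plane).measurableEmbedding]
    simp only [homeomorphUnitSphereProd_smul]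
  rw [e3]
  refine (enorm_integral_le_lintegral_enorm _).trans_eq (lintegral_congr fun θ ↦ ?_)
  rw [Measure.volumeIoiPow]
  simp only [ENNReal.ofReal]
  rw [integral_withDensity_eq_integral_smul (by fun_prop),
    integral_subtype_comap measurableSet_Ioi
      fun r ↦ Real.toNNReal (r ^ 1) • H (r • (θ : Plane))]
  congr 1
  refine setIntegral_congr_fun measurableSet_Ioi fun r hr ↦ ?_
  simp only [NNReal.smul_def, pow_one, Real.coe_toNNReal _ (le_of_lt hr)]
  exact Complex.real_smul

/-- An integral over the circle is dominated by the integral over the unit disc of any function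
that dominates the integrand along rays. -/
theorem lintegral_arcLength_le {J : UnitCircle → ℝ≥0∞} {H : Plane → ℝ≥0∞} (hH : Measurable H)
    (hJ : ∀ θ, ∀ r ∈ Set.Ioo (0 : ℝ) 1, J θ ≤ H (r • (θ : Plane))) :
    ∫⁻ θ, J θ ∂arcLength ≤ 2 * ∫⁻ y in Metric.ball 0 1, H y := by
  have hhalf : ∫⁻ r in Set.Ioo (0 : ℝ) 1, ENNReal.ofReal r = 2⁻¹ := by
    have h := Measure.volumeIoiPow_apply_Iio 1 ⟨1, Set.mem_Ioi.2 one_pos⟩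
    have h2 := lintegral_volumeIoiPow_one ((Set.Iio 1).indicator 1)
      (measurable_one.indicator measurableSet_Iio)
    have h3 : ∫⁻ r : Set.Ioi (0 : ℝ), (Set.Iio (1 : ℝ)).indicator 1 (r : ℝ)
        ∂(Measure.volumeIoiPow 1) = Measure.volumeIoiPow 1 (Set.Iio ⟨1, Set.mem_Ioi.2 one_pos⟩) := by
      rw [← lintegral_indicator_one measurableSet_Iio]
      rfl
    rw [h3, h] at h2
    have h4 : ∫⁻ r in Set.Ioo (0 : ℝ) 1, ENNReal.ofReal r =
        ∫⁻ r in Set.Ioi (0 : ℝ), ENNReal.ofReal r * (Set.Iio (1 : ℝ)).indicator 1 r := by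
      rw [← Set.Ioi_inter_Iio, ← Measure.restrict_restrict_of_subset (s := Set.Ioi (0 : ℝ) ∩ Set.Iio 1) Set.inter_subset_left]
      rw [← lintegral_indicator (measurableSet_Ioi.inter measurableSet_Iio)]
      refine setLIntegral_congr_fun measurableSet_Ioi fun r hr ↦ ?_
      by_cases h1 : r < 1 <;> simp [Set.indicator, h1, Set.mem_Ioi.mp hr]
    rw [h4, ← h2]
    norm_num [ENNReal.ofReal_div_of_pos]
  have h1 : ∫⁻ y in Metric.ball 0 1, H y = ∫⁻ θ, ∫⁻ r in Set.Ioi (0 : ℝ),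
      ENNReal.ofReal r * (Metric.ball 0 1).indicator H (r • (θ : Plane)) ∂volume ∂arcLength := by
    rw [← lintegral_indicator measurableSet_ball, lintegral_polar (hH.indicator measurableSet_ball)]
  have h2 : ∫⁻ θ, J θ * 2⁻¹ ∂arcLength ≤ ∫⁻ y in Metric.ball 0 1, H y := by
    rw [h1]
    refine lintegral_mono fun θ ↦ ?_
    rw [← hhalf, mul_comm]
    calc (∫⁻ r in Set.Ioo (0 : ℝ) 1, ENNReal.ofReal r) * J θ
        = ∫⁻ r in Set.Ioo (0 : ℝ) 1, ENNReal.ofReal r * J θ :=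
          (lintegral_mul_const _ (by fun_prop)).symm
      _ ≤ ∫⁻ r in Set.Ioo (0 : ℝ) 1,
            ENNReal.ofReal r * (Metric.ball 0 1).indicator H (r • (θ : Plane)) := by
          refine setLIntegral_mono' measurableSet_Ioo fun r hr ↦ ?_
          have hmem : r • (θ : Plane) ∈ Metric.ball (0 : Plane) 1 := by
            have : ‖(θ : Plane)‖ = 1 := norm_eq_of_mem_sphere θ
            simp [norm_smul, this, abs_of_pos hr.1, hr.2]
          rw [Set.indicator_of_mem hmem]
          gcongr
          exact hJ θ r hr
      _ ≤ _ := lintegral_mono_set Set.Ioo_subset_Ioi_self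
  rw [lintegral_mul_const' _ _ (by simp)] at h2
  calc ∫⁻ θ, J θ ∂arcLength = 2 * ((∫⁻ θ, J θ ∂arcLength) * 2⁻¹) := by
        rw [mul_comm, mul_assoc, ENNReal.inv_mul_cancel (by simp) (by simp), mul_one]
    _ ≤ _ := by gcongr

theorem lintegral_plane {H : ℝ → ℝ → ℝ≥0∞} (hH : Measurable (Function.uncurry H)) :
    ∫⁻ y : Plane, H (y 0) (y 1) = ∫⁻ u, ∫⁻ v, H u v := by
  have h := lintegral_prod (μ := volume) (ν := volume) (Function.uncurry H) hH.aemeasurable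
  simp only [Function.uncurry_apply_pair] at h
  rw [← h, ← Measure.volume_eq_prod, ← (volume_preserving_finTwoArrow ℝ).lintegral_comp hH,
    ← (EuclideanSpace.volume_preserving_symm_measurableEquiv_toLp (Fin 2)).symm.lintegral_comp
      (by fun_prop)]
  rfl

theorem abs_apply_le_of_mem_ball {y : Plane} (hy : y ∈ Metric.ball (0 : Plane) 1) (i : Fin 2) :
    y i ∈ Set.Icc (-1 : ℝ) 1 := by
  rw [mem_ball_zero_iff] at hy
  exact abs_le.mp ((PiLp.norm_apply_le y i).trans hy.le)

theorem setLIntegral_ball_le {H : ℝ → ℝ → ℝ≥0∞} (hH : Measurable (Function.uncurry H)) :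
    ∫⁻ y in Metric.ball (0 : Plane) 1, H (y 0) (y 1) ≤
      ∫⁻ u in Set.Icc (-1 : ℝ) 1, ∫⁻ v in Set.Icc (-1 : ℝ) 1, H u v := by
  have key := lintegral_plane (H := fun u v ↦ (Set.Icc (-1 : ℝ) 1).indicator
      (fun u ↦ (Set.Icc (-1 : ℝ) 1).indicator (fun v ↦ H u v) v) u) ?_
  · calc ∫⁻ y in Metric.ball (0 : Plane) 1, H (y 0) (y 1)
        ≤ ∫⁻ y : Plane, (Set.Icc (-1 : ℝ) 1).indicator
            (fun u ↦ (Set.Icc (-1 : ℝ) 1).indicator (fun v ↦ H u v) (y 1)) (y 0) := by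
          rw [← lintegral_indicator measurableSet_ball]
          refine lintegral_mono fun y ↦ ?_
          by_cases hy : y ∈ Metric.ball (0 : Plane) 1
          · rw [Set.indicator_of_mem hy, Set.indicator_of_mem (abs_apply_le_of_mem_ball hy 0),
              Set.indicator_of_mem (abs_apply_le_of_mem_ball hy 1)]
          · rw [Set.indicator_of_notMem hy]
            exact zero_le
      _ = _ := by
          rw [key, ← lintegral_indicator measurableSet_Icc]
          refine lintegral_congr fun u ↦ ?_
          by_cases hu : u ∈ Set.Icc (-1 : ℝ) 1
          · simp only [Set.indicator_of_mem hu]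
            rw [lintegral_indicator measurableSet_Icc]
          · simp [Set.indicator_of_notMem hu]
  · have : (Function.uncurry fun u v ↦ (Set.Icc (-1 : ℝ) 1).indicator
        (fun u ↦ (Set.Icc (-1 : ℝ) 1).indicator (fun v ↦ H u v) v) u) =
        (Set.Icc (-1 : ℝ) 1 ×ˢ Set.Icc (-1 : ℝ) 1).indicator (Function.uncurry H) := by
      ext ⟨u, v⟩
      by_cases hu : u ∈ Set.Icc (-1 : ℝ) 1 <;> by_cases hv : v ∈ Set.Icc (-1 : ℝ) 1 <;>
        simp only [Function.uncurry, Set.indicator, Set.mem_prod, hu, hv, and_self, and_false,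
          false_and, if_true, if_false]
    rw [this]
    exact hH.indicator (measurableSet_Icc.prod measurableSet_Icc)

theorem arcLength_univ_le : arcLength Set.univ ≤ 8 := by
  rw [← lintegral_one]
  refine (lintegral_arcLength_le (H := fun _ ↦ 1) measurable_const fun _ _ _ ↦ le_rfl).trans ?_
  calc 2 * ∫⁻ _ in Metric.ball (0 : Plane) 1, (1 : ℝ≥0∞)
      ≤ 2 * ∫⁻ _ in Set.Icc (-1 : ℝ) 1, ∫⁻ _ in Set.Icc (-1 : ℝ) 1, (1 : ℝ≥0∞) := by
        gcongr
        exact setLIntegral_ball_le (H := fun _ _ ↦ 1) measurable_const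
    _ = 8 := by
        simp only [lintegral_const, Measure.restrict_apply_univ, Real.volume_Icc, one_mul]
        norm_num

/-- The arcs around the diagonal have small length. -/
theorem arcLength_near_diagonal_le (δ : ℝ) :
    arcLength {θ | |(θ : Plane) 0 - (θ : Plane) 1| < δ} ≤ 8 * ENNReal.ofReal δ := by
  have hm : MeasurableSet {θ : UnitCircle | |(θ : Plane) 0 - (θ : Plane) 1| < δ} :=
    measurableSet_lt (by fun_prop) measurable_const
  have hm2 : MeasurableSet {p : ℝ × ℝ | |p.1 - p.2| < δ} :=
    measurableSet_lt (by fun_prop) measurable_const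
  rw [← lintegral_indicator_one hm]
  set H : ℝ → ℝ → ℝ≥0∞ := fun u v ↦ {p : ℝ × ℝ | |p.1 - p.2| < δ}.indicator 1 (u, v) with hH
  have hHm : Measurable (Function.uncurry H) := measurable_one.indicator hm2
  refine (lintegral_arcLength_le (H := fun y ↦ H (y 0) (y 1)) ?_ ?_).trans ?_
  · exact hHm.comp (f := fun y : Plane ↦ (y 0, y 1)) (by fun_prop)
  · intro θ r hr
    by_cases hθ : |(θ : Plane) 0 - (θ : Plane) 1| < δ
    · have : |(r • (θ : Plane)) 0 - (r • (θ : Plane)) 1| < δ := by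
        simp only [PiLp.smul_apply, smul_eq_mul, ← mul_sub, abs_mul, abs_of_pos hr.1]
        exact (mul_le_of_le_one_left (abs_nonneg _) hr.2.le).trans_lt hθ
      rw [Set.indicator_of_mem (by exact hθ)]
      simp only [hH]
      rw [Set.indicator_of_mem (by exact this)]
      rfl
    · rw [Set.indicator_of_notMem (by exact hθ)]
      exact zero_le
  · calc 2 * ∫⁻ y in Metric.ball (0 : Plane) 1, H (y 0) (y 1)
        ≤ 2 * ∫⁻ u in Set.Icc (-1 : ℝ) 1, ∫⁻ v in Set.Icc (-1 : ℝ) 1, H u v := by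
          gcongr
          exact setLIntegral_ball_le hHm
      _ ≤ 2 * ∫⁻ u in Set.Icc (-1 : ℝ) 1, ENNReal.ofReal (2 * δ) := by
          gcongr with u
          calc ∫⁻ v in Set.Icc (-1 : ℝ) 1, H u v ≤ ∫⁻ v, H u v := setLIntegral_le_lintegral _ _
            _ = ∫⁻ v, (Metric.ball u δ).indicator 1 v := by
              refine lintegral_congr fun v ↦ ?_
              simp only [hH, Set.indicator, Metric.mem_ball, Real.dist_eq, Set.mem_ofPred_eq,
                abs_sub_comm u v]
              rfl
            _ = _ := by rw [lintegral_indicator_one measurableSet_ball, Real.volume_ball]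
      _ = 8 * ENNReal.ofReal δ := by
          rw [lintegral_const, Measure.restrict_apply_univ, Real.volume_Icc,
            ENNReal.ofReal_mul (by norm_num)]
          norm_num
          ring

/-- The integrable majorant `1 / (1 + ζ²)`. -/
noncomputable def cauchyBump (ζ : ℝ) : ℝ≥0∞ := ENNReal.ofReal (1 + ζ ^ 2)⁻¹

@[fun_prop]
theorem measurable_cauchyBump : Measurable cauchyBump := by
  unfold cauchyBump; fun_prop

theorem lintegral_cauchyBump : ∫⁻ ζ, cauchyBump ζ = ENNReal.ofReal Real.pi := by
  unfold cauchyBump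
  rw [← ofReal_integral_eq_lintegral_ofReal integrable_inv_one_add_sq
    (Filter.Eventually.of_forall fun x ↦ by positivity), integral_univ_inv_one_add_sq]

theorem cauchyBump_le_one (ζ : ℝ) : cauchyBump ζ ≤ 1 := by
  refine ENNReal.ofReal_le_one.mpr (inv_le_one_of_one_le₀ ?_)
  nlinarith [sq_nonneg ζ]

theorem cauchyBump_le_of_mem_Ioo (ζ : ℝ) {r : ℝ} (hr : r ∈ Set.Ioo (0 : ℝ) 1) :
    cauchyBump ζ ≤ cauchyBump (r * ζ) := by
  refine ENNReal.ofReal_le_ofReal (inv_anti₀ (by positivity) ?_)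
  have : r ^ 2 ≤ 1 := pow_le_one₀ hr.1.le hr.2.le
  nlinarith [sq_nonneg ζ]

/-- A quantity bounded both by `8` and by `4π / |t|` is bounded by `8π / (1 + |t|)`. -/
theorem le_of_le_div_of_le {t : ℝ} {L : ℝ≥0∞} (h1 : L ≤ 8)
    (h2 : t ≠ 0 → L ≤ ENNReal.ofReal (4 * Real.pi * |t|⁻¹)) :
    L ≤ ENNReal.ofReal (8 * Real.pi) * ENNReal.ofReal (1 + |t|)⁻¹ := by
  rw [← ENNReal.ofReal_mul (by positivity)]
  by_cases ht : |t| ≤ 1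
  · refine h1.trans ?_
    rw [← ENNReal.ofReal_ofNat]
    refine ENNReal.ofReal_le_ofReal ?_
    rw [← div_eq_mul_inv, le_div_iff₀ (by positivity)]
    nlinarith [Real.pi_gt_three]
  · push Not at ht
    refine (h2 (by rintro rfl; simp at ht; linarith)).trans (ENNReal.ofReal_le_ofReal ?_)
    rw [← div_eq_mul_inv, ← div_eq_mul_inv, div_le_div_iff₀ (by linarith) (by positivity)]
    nlinarith [Real.pi_pos]

theorem lintegral_circle_cauchyBump_le_eight (ξ η : ℝ) :
    ∫⁻ θ, cauchyBump (ξ * (θ : Plane) 0 + η * (θ : Plane) 1) ∂arcLength ≤ 8 := by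
  refine (lintegral_mono fun θ ↦ cauchyBump_le_one _).trans ?_
  rw [lintegral_one]
  exact arcLength_univ_le

theorem lintegral_circle_cauchyBump_le_disc (ξ η : ℝ) :
    ∫⁻ θ, cauchyBump (ξ * (θ : Plane) 0 + η * (θ : Plane) 1) ∂arcLength ≤
      2 * ∫⁻ u in Set.Icc (-1 : ℝ) 1, ∫⁻ v in Set.Icc (-1 : ℝ) 1, cauchyBump (ξ * u + η * v) := by
  refine (lintegral_arcLength_le (H := fun y ↦ cauchyBump (ξ * y 0 + η * y 1)) (by fun_prop)
    fun θ r hr ↦ ?_).trans ?_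
  · refine (cauchyBump_le_of_mem_Ioo _ hr).trans_eq ?_
    congr 1
    simp only [PiLp.smul_apply, smul_eq_mul]
    ring
  · gcongr
    exact setLIntegral_ball_le (H := fun u v ↦ cauchyBump (ξ * u + η * v))
      (by unfold Function.uncurry; fun_prop)

theorem lintegral_Icc_cauchyBump_le {ξ : ℝ} (hξ : ξ ≠ 0) (d : ℝ → ℝ) :
    ∫⁻ v in Set.Icc (-1 : ℝ) 1, ∫⁻ u in Set.Icc (-1 : ℝ) 1, cauchyBump (ξ * u + d v) ≤
      2 * ENNReal.ofReal (|ξ|⁻¹ * Real.pi) := by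
  calc _ ≤ ∫⁻ v in Set.Icc (-1 : ℝ) 1, ENNReal.ofReal (|ξ|⁻¹ * Real.pi) := by
        gcongr with v
        refine (setLIntegral_le_lintegral _ _).trans_eq ?_
        rw [lintegral_comp_mul_add _ hξ, lintegral_cauchyBump, abs_inv,
          ENNReal.ofReal_mul (by positivity)]
    _ = _ := by
        rw [lintegral_const, Measure.restrict_apply_univ, Real.volume_Icc, mul_comm]
        norm_num

/-- A large frequency `ξ` makes the phase `ξ a + η b` small only for few directions `(a, b)`. -/
theorem lintegral_circle_cauchyBump_le_left (ξ η : ℝ) :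
    ∫⁻ θ, cauchyBump (ξ * (θ : Plane) 0 + η * (θ : Plane) 1) ∂arcLength ≤
      ENNReal.ofReal (8 * Real.pi) * ENNReal.ofReal (1 + |ξ|)⁻¹ := by
  refine le_of_le_div_of_le (lintegral_circle_cauchyBump_le_eight ξ η) fun hξ ↦ ?_
  refine (lintegral_circle_cauchyBump_le_disc ξ η).trans ?_
  rw [lintegral_lintegral_swap (by unfold Function.uncurry; fun_prop)]
  calc _ ≤ 2 * (2 * ENNReal.ofReal (|ξ|⁻¹ * Real.pi)) := by
        gcongr
        exact lintegral_Icc_cauchyBump_le hξ fun v ↦ η * v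
    _ = _ := by
        rw [← ENNReal.ofReal_ofNat, ← ENNReal.ofReal_mul (by norm_num),
          ← ENNReal.ofReal_mul (by norm_num)]
        congr 1
        ring

theorem lintegral_circle_cauchyBump_le_right (ξ η : ℝ) :
    ∫⁻ θ, cauchyBump (ξ * (θ : Plane) 0 + η * (θ : Plane) 1) ∂arcLength ≤
      ENNReal.ofReal (8 * Real.pi) * ENNReal.ofReal (1 + |η|)⁻¹ := by
  refine le_of_le_div_of_le (lintegral_circle_cauchyBump_le_eight ξ η) fun hη ↦ ?_
  refine (lintegral_circle_cauchyBump_le_disc ξ η).trans ?_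
  simp only [add_comm (ξ * _)]
  calc _ ≤ 2 * (2 * ENNReal.ofReal (|η|⁻¹ * Real.pi)) := by
        gcongr
        exact lintegral_Icc_cauchyBump_le hη fun v ↦ ξ * v
    _ = _ := by
        rw [← ENNReal.ofReal_ofNat, ← ENNReal.ofReal_mul (by norm_num),
          ← ENNReal.ofReal_mul (by norm_num)]
        congr 1
        ring

/-! ### Fourier decay of the radial weights -/

/-- Two integrations by parts. -/
theorem norm_fourier_le_of_bound {u : ℝ → ℂ} {M : ℝ} (hu : ContDiff ℝ 2 u)
    (hs : tsupport u ⊆ Set.Icc (-2) 2) (h0 : ∀ r, ‖u r‖ ≤ M)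
    (h2 : ∀ r, ‖deriv (deriv u) r‖ ≤ M) (ζ : ℝ) : ‖𝓕 u ζ‖ ≤ 8 * M * (1 + ζ ^ 2)⁻¹ := by
  have hc : HasCompactSupport u := isCompact_Icc.of_isClosed_subset (isClosed_tsupport u) hs
  have hu1 : ContDiff ℝ 1 (deriv u) :=
    ((contDiff_succ_iff_deriv (n := 1)).mp (by simpa using! hu)).2.2
  have hu2 : Continuous (deriv (deriv u)) := hu1.continuous_deriv_one
  have hint : ∀ v : ℝ → ℂ, (∀ r, ‖v r‖ ≤ M) → tsupport v ⊆ tsupport u → ∀ ζ, ‖𝓕 v ζ‖ ≤ 4 * M := by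
    intro v hv hvs ζ
    have h1 : ‖𝓕 v ζ‖ ≤ ∫ r, ‖v r‖ :=
      VectorFourier.norm_fourierIntegral_le_integral_norm _ _ _ _ _
    have h2 : ∫ r, ‖v r‖ = ∫ r in Set.Icc (-2 : ℝ) 2, ‖v r‖ := by
      refine (setIntegral_eq_integral_of_forall_compl_eq_zero fun r hr ↦ ?_).symm
      rw [image_eq_zero_of_notMem_tsupport fun h ↦ hr (hs (hvs h)), norm_zero]
    have h3 : ‖∫ r in Set.Icc (-2 : ℝ) 2, ‖v r‖‖ ≤ M * volume.real (Set.Icc (-2 : ℝ) 2) :=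
      norm_setIntegral_le_of_norm_le_const (by simp) fun r _ ↦ by simpa using hv r
    rw [Real.volume_real_Icc_of_le (by norm_num)] at h3
    have := Real.le_norm_self (∫ r in Set.Icc (-2 : ℝ) 2, ‖v r‖)
    rw [h2] at h1
    linarith
  have i0 : Integrable u := hu.continuous.integrable_of_hasCompactSupport hc
  have i1 : Integrable (deriv u) := hu1.continuous.integrable_of_hasCompactSupport hc.deriv
  have i2 : Integrable (deriv (deriv u)) := hu2.integrable_of_hasCompactSupport hc.deriv.deriv
  have e1 := congrFun (Real.fourier_deriv i0 (hu.differentiable (by norm_num)) i1) ζ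
  have e2 := congrFun (Real.fourier_deriv i1 (hu1.differentiable (by norm_num)) i2) ζ
  have b0 := hint u h0 subset_rfl ζ
  have b2 := hint (deriv (deriv u)) h2
    ((tsupport_deriv_subset).trans (tsupport_deriv_subset)) ζ
  rw [e2, e1, smul_smul, norm_smul] at b2
  have e3 : ‖(2 * Real.pi * Complex.I * ζ) * (2 * Real.pi * Complex.I * ζ)‖ =
      4 * Real.pi ^ 2 * ζ ^ 2 := by
    simp only [norm_mul, Complex.norm_I, Complex.norm_real, Complex.norm_ofNat, Real.norm_eq_abs,
      abs_of_pos Real.pi_pos]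
    rw [← sq_abs ζ]
    ring
  rw [e3] at b2
  rw [← div_eq_mul_inv, le_div_iff₀ (by positivity)]
  have : ζ ^ 2 * ‖𝓕 u ζ‖ ≤ 4 * Real.pi ^ 2 * ζ ^ 2 * ‖𝓕 u ζ‖ := by
    have : 1 ≤ 4 * Real.pi ^ 2 := by nlinarith [Real.pi_gt_three]
    have h5 : 0 ≤ ζ ^ 2 * ‖𝓕 u ζ‖ := by positivity
    nlinarith
  nlinarith

/-- Multiplying a bump function by `exp (τ r²)` keeps the Fourier decay, uniformly for bounded
`τ`. -/
theorem exists_norm_fourier_mul_exp_le {φ : ℝ → ℂ} (hφ : ContDiff ℝ ∞ φ)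
    (hs : tsupport φ ⊆ Set.Icc (-2) 2) :
    ∃ C : ℝ, 0 ≤ C ∧ ∀ τ : ℝ, |τ| ≤ 7 → ∀ ζ,
      ‖𝓕 (fun r ↦ φ r * Complex.exp (τ * r ^ 2)) ζ‖ ≤ C * (1 + ζ ^ 2)⁻¹ := by
  have hc : HasCompactSupport φ := isCompact_Icc.of_isClosed_subset (isClosed_tsupport φ) hs
  have hφ1 : ContDiff ℝ ∞ (deriv φ) :=
    ((contDiff_infty_iff_deriv).mp hφ).2
  have hφ2 : ContDiff ℝ ∞ (deriv (deriv φ)) := ((contDiff_infty_iff_deriv).mp hφ1).2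
  obtain ⟨B0, hB0⟩ := hφ.continuous.bounded_above_of_compact_support hc
  obtain ⟨B1, hB1⟩ := hφ1.continuous.bounded_above_of_compact_support hc.deriv
  obtain ⟨B2, hB2⟩ := hφ2.continuous.bounded_above_of_compact_support hc.deriv.deriv
  have p0 : 0 ≤ B0 := (norm_nonneg _).trans (hB0 0)
  have p1 : 0 ≤ B1 := (norm_nonneg _).trans (hB1 0)
  have p2 : 0 ≤ B2 := (norm_nonneg _).trans (hB2 0)
  set M : ℝ := (B2 + 56 * B1 + 798 * B0) * Real.exp 28 with hM
  refine ⟨8 * M, by positivity, fun τ hτ ζ ↦ norm_fourier_le_of_bound ?_ ?_ ?_ ?_ ζ⟩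
  · have : ContDiff ℝ 2 φ := contDiff_infty.mp hφ 2
    have h2 : ContDiff ℝ 2 fun r : ℝ ↦ (r : ℂ) := Complex.ofRealCLM.contDiff
    fun_prop
  · exact (tsupport_mul_subset_left).trans hs
  · intro r
    by_cases hr : r ∈ Set.Icc (-2 : ℝ) 2
    · have hexp : ‖Complex.exp (τ * r ^ 2)‖ ≤ Real.exp 28 := by
        rw [Complex.norm_exp, Real.exp_le_exp]
        have : ((τ : ℂ) * r ^ 2).re = τ * r ^ 2 := by norm_cast
        rw [this]
        nlinarith [abs_le.mp hτ, hr.1, hr.2, sq_nonneg r]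
      rw [norm_mul, hM]
      gcongr
      linarith [hB0 r]
    · rw [image_eq_zero_of_notMem_tsupport fun h ↦ hr (hs h)]
      simp only [zero_mul, norm_zero]
      positivity
  · have d0 : ∀ r, HasDerivAt φ (deriv φ r) r := fun r ↦
      (hφ.differentiable (by simp) r).hasDerivAt
    have d1 : ∀ r, HasDerivAt (deriv φ) (deriv (deriv φ) r) r := fun r ↦
      (hφ1.differentiable (by simp) r).hasDerivAt
    have dr : ∀ r : ℝ, HasDerivAt (fun r : ℝ ↦ (r : ℂ)) 1 r := fun r ↦
      Complex.ofRealCLM.hasDerivAt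
    have de : ∀ r : ℝ, HasDerivAt (fun r : ℝ ↦ Complex.exp (τ * (r : ℂ) ^ 2))
        (Complex.exp (τ * (r : ℂ) ^ 2) * (τ * (2 * r))) r := fun r ↦ by
      have := (((dr r).pow 2).const_mul (τ : ℂ)).cexp
      simpa using this
    have e1 : deriv (fun r ↦ φ r * Complex.exp (τ * r ^ 2)) =
        fun r : ℝ ↦ (deriv φ r + 2 * τ * (r * φ r)) * Complex.exp (τ * r ^ 2) := by
      ext r
      refine ((d0 r).mul (de r)).deriv.trans ?_
      ring
    have e2 : ∀ r : ℝ, deriv (deriv (fun r ↦ φ r * Complex.exp (τ * r ^ 2))) r =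
        (deriv (deriv φ) r + 4 * τ * r * deriv φ r + (2 * τ + 4 * τ ^ 2 * r ^ 2) * φ r) *
          Complex.exp (τ * r ^ 2) := by
      intro r
      rw [e1]
      refine (((d1 r).add (((dr r).mul (d0 r)).const_mul (2 * (τ : ℂ)))).mul (de r)).deriv.trans ?_
      simp only [Pi.add_apply, Pi.mul_apply]
      ring
    intro r
    rw [e2]
    by_cases hr : r ∈ Set.Icc (-2 : ℝ) 2
    · have hexp : ‖Complex.exp (τ * r ^ 2)‖ ≤ Real.exp 28 := by
        rw [Complex.norm_exp, Real.exp_le_exp]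
        have : ((τ : ℂ) * r ^ 2).re = τ * r ^ 2 := by norm_cast
        rw [this]
        nlinarith [abs_le.mp hτ, hr.1, hr.2, sq_nonneg r]
      have hr' : |r| ≤ 2 := abs_le.mpr hr
      rw [norm_mul, hM]
      gcongr
      have c1 : ‖4 * (τ : ℂ) * r * deriv φ r‖ ≤ 56 * B1 := by
        simp only [norm_mul, Complex.norm_real, Complex.norm_ofNat, Real.norm_eq_abs]
        calc 4 * |τ| * |r| * ‖deriv φ r‖ ≤ 4 * 7 * 2 * B1 := by gcongr; exact hB1 r
          _ = _ := by ring
      have c2 : ‖(2 * (τ : ℂ) + 4 * τ ^ 2 * r ^ 2) * φ r‖ ≤ 798 * B0 := by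
        rw [norm_mul]
        have : ‖2 * (τ : ℂ) + 4 * τ ^ 2 * r ^ 2‖ ≤ 798 := by
          refine (norm_add_le _ _).trans ?_
          simp only [norm_mul, norm_pow, Complex.norm_real, Complex.norm_ofNat, Real.norm_eq_abs]
          calc 2 * |τ| + 4 * |τ| ^ 2 * |r| ^ 2 ≤ 2 * 7 + 4 * 7 ^ 2 * 2 ^ 2 := by gcongr
            _ = 798 := by norm_num
        gcongr
        exact hB0 r
      calc _ ≤ ‖deriv (deriv φ) r‖ + ‖4 * (τ : ℂ) * r * deriv φ r‖ +
            ‖(2 * (τ : ℂ) + 4 * τ ^ 2 * r ^ 2) * φ r‖ := norm_add₃_le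
        _ ≤ _ := by gcongr; exact hB2 r
    · have z0 : φ r = 0 := image_eq_zero_of_notMem_tsupport fun h ↦ hr (hs h)
      have z1 : deriv φ r = 0 :=
        image_eq_zero_of_notMem_tsupport fun h ↦ hr (hs (tsupport_deriv_subset h))
      have z2 : deriv (deriv φ) r = 0 := image_eq_zero_of_notMem_tsupport
        fun h ↦ hr (hs (tsupport_deriv_subset (tsupport_deriv_subset h)))
      rw [z0, z1, z2]
      simp only [mul_zero, add_zero, zero_mul, norm_zero]
      positivity

/-- The radial profile `√3 β(r) / r`; the constant normalises the Gaussian partition of unity. -/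
noncomputable def radialProfile (β : ℝ → ℂ) (r : ℝ) : ℂ := (√3 : ℝ) * (β r / r)

/-- The radial weight `√3 β(r) exp (τ r²) / r`. -/
noncomputable def radialWeight (β : ℝ → ℂ) (τ r : ℝ) : ℂ :=
  radialProfile β r * Complex.exp (τ * r ^ 2)

section Radial

variable {β : ℝ → ℂ}

theorem tsupport_radialProfile_subset : tsupport (radialProfile β) ⊆ tsupport β := by
  refine closure_mono fun r hr ↦ ?_
  simp only [Function.mem_support, radialProfile] at hr ⊢
  rintro h
  simp [h] at hr

theorem tsupport_radialWeight_subset (τ : ℝ) : tsupport (radialWeight β τ) ⊆ tsupport β :=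
  tsupport_mul_subset_left.trans tsupport_radialProfile_subset

theorem contDiff_radialProfile (hβ : ContDiff ℝ ∞ β) (hs : tsupport β ⊆ Set.Ioo (2⁻¹ : ℝ) 2) :
    ContDiff ℝ ∞ (radialProfile β) := by
  rw [contDiff_iff_contDiffAt]
  intro r
  by_cases hr : r = 0
  · have h0 : (0 : ℝ) ∉ tsupport (radialProfile β) := fun h ↦ by
      have := (hs (tsupport_radialProfile_subset h)).1
      norm_num at this
    rw [hr]
    exact (contDiffAt_const (c := (0 : ℂ))).congr_of_eventuallyEq
      (notMem_tsupport_iff_eventuallyEq.mp h0)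
  · unfold radialProfile
    simp only [div_eq_mul_inv]
    have h2 : ContDiff ℝ ∞ fun r : ℝ ↦ (r : ℂ) := Complex.ofRealCLM.contDiff
    exact contDiffAt_const.mul (hβ.contDiffAt.mul (h2.contDiffAt.inv (Complex.ofReal_ne_zero.mpr hr)))

theorem continuous_radialWeight (hβ : ContDiff ℝ ∞ β) (hs : tsupport β ⊆ Set.Ioo (2⁻¹ : ℝ) 2)
    (τ : ℝ) : Continuous (radialWeight β τ) := by
  have := (contDiff_radialProfile hβ hs).continuous
  unfold radialWeight
  fun_prop

theorem hasCompactSupport_radialWeight (hc : HasCompactSupport β) (τ : ℝ) :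
    HasCompactSupport (radialWeight β τ) :=
  hc.of_isClosed_subset (isClosed_tsupport _) (tsupport_radialWeight_subset τ)

theorem exists_enorm_fourier_radialWeight_le (hβ : ContDiff ℝ ∞ β)
    (hs : tsupport β ⊆ Set.Ioo (2⁻¹ : ℝ) 2) :
    ∃ C : ℝ≥0∞, C ≠ ⊤ ∧ ∀ τ : ℝ, |τ| ≤ 7 → ∀ ζ,
      ‖𝓕 (radialWeight β τ) ζ‖ₑ ≤ C * cauchyBump ζ := by
  obtain ⟨C, hC, h⟩ := exists_norm_fourier_mul_exp_le (contDiff_radialProfile hβ hs)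
    ((tsupport_radialProfile_subset.trans hs).trans fun r hr ↦ ⟨by linarith [hr.1], hr.2.le⟩)
  refine ⟨ENNReal.ofReal C, ENNReal.ofReal_ne_top, fun τ hτ ζ ↦ ?_⟩
  rw [cauchyBump, ← ENNReal.ofReal_mul hC, ← ofReal_norm]
  exact ENNReal.ofReal_le_ofReal (h τ hτ ζ)

end Radial

/-! ### The kernel -/

section Kernel

variable {β : ℝ → ℂ} {Ω : UnitCircle → ℂ}

theorem norm_smul_circle (θ : UnitCircle) {r : ℝ} (hr : 0 < r) : ‖r • (θ : Plane)‖ = r := by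
  rw [norm_smul, norm_eq_of_mem_sphere θ, mul_one, Real.norm_of_nonneg hr.le]

theorem smul_circle_ne_zero (θ : UnitCircle) {r : ℝ} (hr : 0 < r) : r • (θ : Plane) ≠ 0 := by
  rw [← norm_ne_zero_iff, norm_smul_circle θ hr]
  exact hr.ne'

theorem direction_smul_circle (θ : UnitCircle) {r : ℝ} (hr : 0 < r) :
    direction (r • (θ : Plane)) (smul_circle_ne_zero θ hr) = θ := by
  refine Subtype.ext ?_
  simp only [direction]
  rw [norm_smul_circle θ hr, smul_smul, inv_mul_cancel₀ hr.ne', one_smul]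

theorem measurable_direction : Measurable fun y : {y : Plane | y ≠ 0} ↦ direction y y.2 := by
  unfold direction
  refine Measurable.subtype_mk ?_
  fun_prop

theorem singleScaleKernel_smul (θ : UnitCircle) {r : ℝ} (hr : 0 < r) :
    singleScaleKernel β Ω (r • (θ : Plane)) = Ω θ * (r : ℂ)⁻¹ * (β r / r) := by
  rw [singleScaleKernel, dif_pos (smul_circle_ne_zero θ hr), direction_smul_circle θ hr,
    norm_smul_circle θ hr]
  have : (r : ℂ) ≠ 0 := by exact_mod_cast hr.ne'
  push_cast
  field_simp

theorem measurable_singleScaleKernel (hβ : Measurable β) (hΩ : Measurable Ω) :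
    Measurable (singleScaleKernel β Ω) := by
  unfold singleScaleKernel
  refine Measurable.dite (s := {y : Plane | y ≠ 0})
    (f := fun y ↦ Ω (direction y y.2) * ((‖(y : Plane)‖ ^ (-2 : ℤ) : ℝ) : ℂ) * β ‖(y : Plane)‖)
    (g := fun _ ↦ 0) ?_ measurable_const (measurableSet_singleton 0).compl
  have := measurable_direction
  fun_prop

theorem singleScaleKernel_add (Ω₁ Ω₂ : UnitCircle → ℂ) (y : Plane) :
    singleScaleKernel β (Ω₁ + Ω₂) y = singleScaleKernel β Ω₁ y + singleScaleKernel β Ω₂ y := by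
  unfold singleScaleKernel
  split_ifs
  · simp only [Pi.add_apply]
    ring
  · simp

theorem lintegral_singleScaleKernel (hβ : Measurable β) (hΩ : Measurable Ω) :
    ∫⁻ y, ‖singleScaleKernel β Ω y‖ₑ =
      (∫⁻ θ, ‖Ω θ‖ₑ ∂arcLength) * ∫⁻ r in Set.Ioi (0 : ℝ), ‖β r / r‖ₑ := by
  rw [lintegral_polar (measurable_singleScaleKernel hβ hΩ).enorm,
    ← lintegral_mul_const _ hΩ.enorm]
  refine lintegral_congr fun θ ↦ ?_
  rw [← lintegral_const_mul _ (by fun_prop)]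
  refine setLIntegral_congr_fun measurableSet_Ioi fun r hr ↦ ?_
  have hr : 0 < r := hr
  have h1 : ENNReal.ofReal r = ‖(r : ℂ)‖ₑ := by
    rw [← ofReal_norm, Complex.norm_real, Real.norm_of_nonneg hr.le]
  rw [singleScaleKernel_smul θ hr, h1, ← enorm_mul, ← enorm_mul]
  congr 1
  have : (r : ℂ) ≠ 0 := by exact_mod_cast hr.ne'
  field_simp

theorem lintegral_radial_lt_top (hβ : ContDiff ℝ ∞ β) (hc : HasCompactSupport β)
    (hs : tsupport β ⊆ Set.Ioo (2⁻¹ : ℝ) 2) : ∫⁻ r in Set.Ioi (0 : ℝ), ‖β r / r‖ₑ < ⊤ := by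
  have h := (contDiff_radialProfile hβ hs).continuous.integrable_of_hasCompactSupport
    (μ := volume) (hc.of_isClosed_subset (isClosed_tsupport _) tsupport_radialProfile_subset)
  have h2 : Integrable fun r : ℝ ↦ β r / r := by
    refine (h.const_mul ((√3 : ℝ) : ℂ)⁻¹).congr (Filter.Eventually.of_forall fun r ↦ ?_)
    simp only [radialProfile]
    rw [inv_mul_cancel_left₀]
    norm_num
  exact (setLIntegral_le_lintegral _ _).trans_lt (hasFiniteIntegral_iff_enorm.mp h2.2)

/-- The kernel multiplied by the factor that compensates for three Gaussian windows, the inverse of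
`∫ s, G (x - y₁ - s) G (x - y₂ - s) G (x - s)` with `G` the Gaussian window. -/
noncomputable def compensatedKernel (β : ℝ → ℂ) (Ω : UnitCircle → ℂ) (y : Plane) : ℂ :=
  singleScaleKernel β Ω y *
    ((√3 * Real.exp (2 * Real.pi / 3 * (y 0 ^ 2 + y 1 ^ 2 - y 0 * y 1)) : ℝ) : ℂ)

theorem measurable_compensatedKernel (hβ : Measurable β) (hΩ : Measurable Ω) :
    Measurable (compensatedKernel β Ω) := by
  have := measurable_singleScaleKernel hβ hΩ
  unfold compensatedKernel
  fun_prop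

/-- The exponent of the radial weight in the direction `θ`: on the ray through `θ` the quadratic
form `2π / 3 (a² + b² - a b)` equals `windowExponent θ * r²`. -/
noncomputable def windowExponent (θ : UnitCircle) : ℝ :=
  2 * Real.pi / 3 * (1 - (θ : Plane) 0 * (θ : Plane) 1)

theorem sq_add_sq_circle (θ : UnitCircle) : (θ : Plane) 0 ^ 2 + (θ : Plane) 1 ^ 2 = 1 := by
  have h : ‖(θ : Plane)‖ = 1 := norm_eq_of_mem_sphere θ
  have h2 := EuclideanSpace.norm_sq_eq (θ : Plane)
  rw [h] at h2
  simp only [Fin.sum_univ_two, Real.norm_eq_abs, sq_abs] at h2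
  linarith

theorem abs_windowExponent_le (θ : UnitCircle) : |windowExponent θ| ≤ 7 := by
  have h := sq_add_sq_circle θ
  have h1 : |1 - (θ : Plane) 0 * (θ : Plane) 1| ≤ 3 / 2 := by
    rw [abs_le]
    constructor <;> nlinarith [sq_nonneg ((θ : Plane) 0 - (θ : Plane) 1),
      sq_nonneg ((θ : Plane) 0 + (θ : Plane) 1)]
  rw [windowExponent, abs_mul, abs_of_pos (by positivity)]
  nlinarith [Real.pi_lt_four, Real.pi_pos, Real.pi_lt_d2]

theorem mul_compensatedKernel_smul (θ : UnitCircle) {r : ℝ} (hr : 0 < r) :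
    (r : ℂ) * compensatedKernel β Ω (r • (θ : Plane)) =
      Ω θ * radialWeight β (windowExponent θ) r := by
  have h1 : 2 * Real.pi / 3 * ((r • (θ : Plane)) 0 ^ 2 + (r • (θ : Plane)) 1 ^ 2 -
      (r • (θ : Plane)) 0 * (r • (θ : Plane)) 1) = windowExponent θ * r ^ 2 := by
    simp only [PiLp.smul_apply, smul_eq_mul, windowExponent]
    linear_combination (2 * Real.pi / 3 * r ^ 2) * sq_add_sq_circle θ
  rw [compensatedKernel, singleScaleKernel_smul θ hr, h1, radialWeight, radialProfile]
  have : (r : ℂ) ≠ 0 := by exact_mod_cast hr.ne'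
  push_cast
  field_simp

end Kernel

/-! ### The localised trilinear estimate -/

theorem lintegral_convolution_prod {U V : ℝ → ℝ≥0∞} (hU : Measurable U) (hV : Measurable V) :
    ∫⁻ p : ℝ × ℝ, U p.2 * V (p.1 - p.2) = (∫⁻ ξ, U ξ) * ∫⁻ η, V η := by
  rw [Measure.volume_eq_prod, lintegral_prod_symm _ (by fun_prop), ← lintegral_mul_const _ hU]
  refine lintegral_congr fun ξ ↦ ?_
  simp only
  rw [lintegral_const_mul _ (by fun_prop), lintegral_sub_right_eq_self V]

theorem lintegral_circle_convolution_le_left {U V : ℝ → ℝ≥0∞} (hU : Measurable U)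
    (hV : Measurable V) :
    ∫⁻ z : UnitCircle × (ℝ × ℝ), U z.2.2 * V (z.2.1 - z.2.2) *
        cauchyBump ((z.1 : Plane) 0 * z.2.2 + (z.1 : Plane) 1 * (z.2.1 - z.2.2))
        ∂(arcLength.prod volume) ≤
      ENNReal.ofReal (8 * Real.pi) *
        ((∫⁻ ξ, ENNReal.ofReal (1 + |ξ|)⁻¹ * U ξ) * ∫⁻ η, V η) := by
  rw [lintegral_prod_symm _ (by fun_prop), ← lintegral_convolution_prod (by fun_prop) hV,
    ← lintegral_const_mul _ (by fun_prop)]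
  refine lintegral_mono fun p ↦ ?_
  simp only
  rw [lintegral_const_mul _ (by fun_prop)]
  have h := lintegral_circle_cauchyBump_le_left p.2 (p.1 - p.2)
  simp only [mul_comm (p.2), mul_comm (p.1 - p.2)] at h
  calc _ ≤ U p.2 * V (p.1 - p.2) * _ := mul_le_mul_right h _
    _ = _ := by ring

theorem lintegral_circle_convolution_le_right {U V : ℝ → ℝ≥0∞} (hU : Measurable U)
    (hV : Measurable V) :
    ∫⁻ z : UnitCircle × (ℝ × ℝ), U z.2.2 * V (z.2.1 - z.2.2) *
        cauchyBump ((z.1 : Plane) 0 * z.2.2 + (z.1 : Plane) 1 * (z.2.1 - z.2.2))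
        ∂(arcLength.prod volume) ≤
      ENNReal.ofReal (8 * Real.pi) *
        ((∫⁻ ξ, U ξ) * ∫⁻ η, ENNReal.ofReal (1 + |η|)⁻¹ * V η) := by
  rw [lintegral_prod_symm _ (by fun_prop), ← lintegral_convolution_prod hU (by fun_prop),
    ← lintegral_const_mul _ (by fun_prop)]
  refine lintegral_mono fun p ↦ ?_
  simp only
  rw [lintegral_const_mul _ (by fun_prop)]
  have h := lintegral_circle_cauchyBump_le_right p.2 (p.1 - p.2)
  simp only [mul_comm (p.2), mul_comm (p.1 - p.2)] at h
  calc _ ≤ U p.2 * V (p.1 - p.2) * _ := mul_le_mul_right h _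
    _ = _ := by ring

/-- Away from the diagonal directions, the lines in frequency space along which the radial weight
concentrates are transversal to the fibres of `(ξ, η) ↦ ξ + η`. -/
theorem lintegral_circle_dual_le {P : UnitCircle → ℝ≥0∞} {V : ℝ → ℝ≥0∞} (hP : Measurable P)
    (hV : Measurable V) {M : ℝ≥0∞} (hM : ∀ θ, P θ ≤ M) {δ : ℝ} (hδ : 0 < δ)
    (hd : ∀ θ, P θ ≠ 0 → δ ≤ |(θ : Plane) 0 - (θ : Plane) 1|) :
    ∫⁻ z : UnitCircle × (ℝ × ℝ), P z.1 * V z.2.1 *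
        cauchyBump ((z.1 : Plane) 0 * z.2.2 + (z.1 : Plane) 1 * (z.2.1 - z.2.2))
        ∂(arcLength.prod volume) ≤
      ENNReal.ofReal (8 * Real.pi) * (M * ENNReal.ofReal δ⁻¹ * ∫⁻ k, V k) := by
  rw [lintegral_prod _ (by fun_prop)]
  calc _ ≤ ∫⁻ _ : UnitCircle,
        M * (∫⁻ k, V k) * (ENNReal.ofReal δ⁻¹ * ENNReal.ofReal Real.pi) ∂arcLength := by
        refine lintegral_mono fun θ ↦ ?_
        simp only
        by_cases h0 : P θ = 0
        · simp [h0]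
        have hδθ := hd θ h0
        have hne : (θ : Plane) 0 - (θ : Plane) 1 ≠ 0 := by
          intro h
          rw [h, abs_zero] at hδθ
          linarith
        rw [Measure.volume_eq_prod, lintegral_prod _ (by fun_prop)]
        have hk : ∀ k, ∫⁻ ξ, P θ * V k *
            cauchyBump ((θ : Plane) 0 * ξ + (θ : Plane) 1 * (k - ξ)) ≤
            P θ * V k * (ENNReal.ofReal δ⁻¹ * ENNReal.ofReal Real.pi) := by
          intro k
          rw [lintegral_const_mul _ (by fun_prop)]
          gcongr
          have e : ∀ ξ, (θ : Plane) 0 * ξ + (θ : Plane) 1 * (k - ξ) =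
              ((θ : Plane) 0 - (θ : Plane) 1) * ξ + (θ : Plane) 1 * k := fun ξ ↦ by ring
          simp only [e]
          rw [lintegral_comp_mul_add _ hne, lintegral_cauchyBump, abs_inv]
          gcongr
        refine (lintegral_mono hk).trans ?_
        rw [lintegral_mul_const _ (by fun_prop), lintegral_const_mul _ hV]
        gcongr
        exact hM θ
    _ ≤ M * (∫⁻ k, V k) * (ENNReal.ofReal δ⁻¹ * ENNReal.ofReal Real.pi) * 8 := by
        rw [lintegral_const]
        gcongr
        exact arcLength_univ_le
    _ = _ := by
        rw [ENNReal.ofReal_mul (by norm_num), ENNReal.ofReal_ofNat]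
        ring

section Local

variable {β : ℝ → ℂ} {Ω : UnitCircle → ℂ} {g₁ g₂ g₃ : ℝ → ℂ} {C M : ℝ≥0∞} {δ : ℝ}

/-- The trilinear form in polar coordinates, on the Fourier side. -/
theorem enorm_compensated_form_le (hβ : ContDiff ℝ ∞ β) (hc : HasCompactSupport β)
    (hs : tsupport β ⊆ Set.Ioo (2⁻¹ : ℝ) 2)
    (hC : ∀ τ : ℝ, |τ| ≤ 7 → ∀ ζ, ‖𝓕 (radialWeight β τ) ζ‖ₑ ≤ C * cauchyBump ζ)
    (m₁ : Measurable g₁) (m₂ : Measurable g₂)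
    (m₃ : Measurable g₃) (i₁ : Integrable g₁) (h₁ : MemLp g₁ 2)
    (i₂ : Integrable g₂) (h₂ : MemLp g₂ 2) (i₃ : Integrable g₃) (h₃ : MemLp g₃ 2)
    (hm : Measurable Ω)
    (hd : ∀ θ, Ω θ ≠ 0 → (θ : Plane) 0 ≠ (θ : Plane) 1) :
    ‖∫ y, ∫ x, compensatedKernel β Ω y * g₁ (x - y 0) * g₂ (x - y 1) * conj (g₃ x)‖ₑ ≤
      C * ∫⁻ z : UnitCircle × (ℝ × ℝ), ‖Ω z.1‖ₑ *
        (‖𝓕 g₁ z.2.2‖ₑ * ‖𝓕 g₂ (z.2.1 - z.2.2)‖ₑ *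
          cauchyBump ((z.1 : Plane) 0 * z.2.2 + (z.1 : Plane) 1 * (z.2.1 - z.2.2)) *
          ‖𝓕 g₃ z.2.1‖ₑ) ∂(arcLength.prod volume) := by
  have c₁ := (Real.continuous_fourier_of_integrable i₁).measurable
  have c₂ := (Real.continuous_fourier_of_integrable i₂).measurable
  have c₃ := (Real.continuous_fourier_of_integrable i₃).measurable
  have cw := continuous_radialWeight hβ hs
  have iw : ∀ τ, Integrable (radialWeight β τ) := fun τ ↦
    (cw τ).integrable_of_hasCompactSupport (hasCompactSupport_radialWeight hc τ)
  have lw : ∀ τ, MemLp (radialWeight β τ) 2 := fun τ ↦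
    (cw τ).memLp_of_hasCompactSupport (hasCompactSupport_radialWeight hc τ)
  rw [lintegral_prod _ (by fun_prop), ← lintegral_const_mul _ (by fun_prop)]
  refine (enorm_integral_le_polar _).trans (lintegral_mono fun θ ↦ ?_)
  have e : ∫ r in Set.Ioi (0 : ℝ), (r : ℂ) * ∫ x, compensatedKernel β Ω (r • (θ : Plane)) *
        g₁ (x - (r • (θ : Plane)) 0) * g₂ (x - (r • (θ : Plane)) 1) * conj (g₃ x) =
      Ω θ * ∫ r, ∫ x, radialWeight β (windowExponent θ) r * g₁ (x - r * (θ : Plane) 0) *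
        g₂ (x - r * (θ : Plane) 1) * conj (g₃ x) := by
    have e0 : ∫ r, ∫ x, radialWeight β (windowExponent θ) r * g₁ (x - r * (θ : Plane) 0) *
          g₂ (x - r * (θ : Plane) 1) * conj (g₃ x) =
        ∫ r in Set.Ioi (0 : ℝ), ∫ x, radialWeight β (windowExponent θ) r *
          g₁ (x - r * (θ : Plane) 0) * g₂ (x - r * (θ : Plane) 1) * conj (g₃ x) := by
      refine (setIntegral_eq_integral_of_forall_compl_eq_zero fun r hr ↦ ?_).symm
      have : radialWeight β (windowExponent θ) r = 0 :=
        image_eq_zero_of_notMem_tsupport fun h ↦ hr (by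
          have := (hs (tsupport_radialWeight_subset _ h)).1
          exact Set.mem_Ioi.mpr (lt_trans (by norm_num) this))
      simp [this]
    rw [e0, ← integral_const_mul]
    refine setIntegral_congr_fun measurableSet_Ioi fun r hr ↦ ?_
    simp only [PiLp.smul_apply, smul_eq_mul]
    rw [← integral_const_mul, ← integral_const_mul]
    refine integral_congr_ae (Filter.Eventually.of_forall fun x ↦ ?_)
    simp only
    linear_combination (g₁ (x - r * (θ : Plane) 0) * g₂ (x - r * (θ : Plane) 1) *
      conj (g₃ x)) * mul_compensatedKernel_smul (β := β) (Ω := Ω) θ hr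
  rw [e, enorm_mul]
  simp only
  by_cases h0 : Ω θ = 0
  · simp [h0]
  rw [lintegral_const_mul _ (by fun_prop), mul_left_comm]
  gcongr
  refine (enorm_directional_form_le m₁ m₂ m₃ (cw _).measurable i₁ h₁ i₂ h₂ i₃ h₃ (iw _) (lw _)
    (hd θ h0)).trans ?_
  rw [← lintegral_const_mul _ (by fun_prop), Measure.volume_eq_prod,
    lintegral_prod _ (by fun_prop)]
  refine lintegral_mono fun k ↦ lintegral_mono fun ξ ↦ ?_
  simp only
  calc _ ≤ ‖𝓕 g₁ ξ‖ₑ * ‖𝓕 g₂ (k - ξ)‖ₑ *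
        (C * cauchyBump ((θ : Plane) 0 * ξ + (θ : Plane) 1 * (k - ξ))) * ‖𝓕 g₃ k‖ₑ := by
        gcongr
        exact hC _ (abs_windowExponent_le θ) _
    _ = _ := by ring

/-- Cauchy–Schwarz in direction and frequencies, with the bump split evenly between `g₁ g₂` and
`Ω g₃`. -/
theorem enorm_compensated_form_sq_le (hβ : ContDiff ℝ ∞ β) (hc : HasCompactSupport β)
    (hs : tsupport β ⊆ Set.Ioo (2⁻¹ : ℝ) 2)
    (hC : ∀ τ : ℝ, |τ| ≤ 7 → ∀ ζ, ‖𝓕 (radialWeight β τ) ζ‖ₑ ≤ C * cauchyBump ζ)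
    (m₁ : Measurable g₁) (m₂ : Measurable g₂)
    (m₃ : Measurable g₃) (i₁ : Integrable g₁) (h₁ : MemLp g₁ 2)
    (i₂ : Integrable g₂) (h₂ : MemLp g₂ 2) (i₃ : Integrable g₃) (h₃ : MemLp g₃ 2)
    (hm : Measurable Ω) (hM : ∀ θ, ‖Ω θ‖ₑ ≤ M) (hδ : 0 < δ)
    (hd : ∀ θ, Ω θ ≠ 0 → δ ≤ |(θ : Plane) 0 - (θ : Plane) 1|) :
    ‖∫ y, ∫ x, compensatedKernel β Ω y * g₁ (x - y 0) * g₂ (x - y 1) * conj (g₃ x)‖ₑ ^ 2 ≤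
      C ^ 2 * (∫⁻ z : UnitCircle × (ℝ × ℝ), ‖𝓕 g₁ z.2.2‖ₑ ^ 2 * ‖𝓕 g₂ (z.2.1 - z.2.2)‖ₑ ^ 2 *
          cauchyBump ((z.1 : Plane) 0 * z.2.2 + (z.1 : Plane) 1 * (z.2.1 - z.2.2))
          ∂(arcLength.prod volume)) *
        (ENNReal.ofReal (8 * Real.pi) * (M ^ 2 * ENNReal.ofReal δ⁻¹ * ∫⁻ x, ‖g₃ x‖ₑ ^ 2)) := by
  have c₁ := (Real.continuous_fourier_of_integrable i₁).measurable
  have c₂ := (Real.continuous_fourier_of_integrable i₂).measurable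
  have c₃ := (Real.continuous_fourier_of_integrable i₃).measurable
  have hd' : ∀ θ, Ω θ ≠ 0 → (θ : Plane) 0 ≠ (θ : Plane) 1 := by
    intro θ h0 h
    have := hd θ h0
    rw [h, sub_self, abs_zero] at this
    linarith
  have key := enorm_compensated_form_le hβ hc hs hC m₁ m₂ m₃ i₁ h₁ i₂ h₂ i₃ h₃ hm hd'
  set bump : UnitCircle × (ℝ × ℝ) → ℝ≥0∞ := fun z ↦
    cauchyBump ((z.1 : Plane) 0 * z.2.2 + (z.1 : Plane) 1 * (z.2.1 - z.2.2)) with hbump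
  have mb : Measurable bump := by fun_prop
  have hsq : ∀ z, bump z ^ (1 / 2 : ℝ) * bump z ^ (1 / 2 : ℝ) = bump z := fun z ↦ by
    rw [← ENNReal.rpow_add_of_nonneg _ _ (by norm_num) (by norm_num)]
    norm_num
  have cs := ENNReal.sq_lintegral_mul_le (μ := arcLength.prod volume)
    (f := fun z : UnitCircle × (ℝ × ℝ) ↦
      ‖𝓕 g₁ z.2.2‖ₑ * ‖𝓕 g₂ (z.2.1 - z.2.2)‖ₑ * bump z ^ (1 / 2 : ℝ))
    (g := fun z ↦ ‖Ω z.1‖ₑ * ‖𝓕 g₃ z.2.1‖ₑ * bump z ^ (1 / 2 : ℝ)) (by fun_prop) (by fun_prop)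
  have dual := lintegral_circle_dual_le (P := fun θ ↦ ‖Ω θ‖ₑ ^ 2) (V := fun k ↦ ‖𝓕 g₃ k‖ₑ ^ 2)
    (by fun_prop) (by fun_prop) (M := M ^ 2) (fun θ ↦ by gcongr; exact hM θ) hδ
    (fun θ h0 ↦ hd θ fun h ↦ h0 (by simp [h]))
  rw [Real.lintegral_fourier_sq i₃ h₃] at dual
  calc _ ≤ (C * ∫⁻ z : UnitCircle × (ℝ × ℝ), ‖Ω z.1‖ₑ *
        (‖𝓕 g₁ z.2.2‖ₑ * ‖𝓕 g₂ (z.2.1 - z.2.2)‖ₑ * bump z * ‖𝓕 g₃ z.2.1‖ₑ)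
        ∂(arcLength.prod volume)) ^ 2 := by
        gcongr
    _ = C ^ 2 * (∫⁻ z : UnitCircle × (ℝ × ℝ),
          (‖𝓕 g₁ z.2.2‖ₑ * ‖𝓕 g₂ (z.2.1 - z.2.2)‖ₑ * bump z ^ (1 / 2 : ℝ)) *
          (‖Ω z.1‖ₑ * ‖𝓕 g₃ z.2.1‖ₑ * bump z ^ (1 / 2 : ℝ)) ∂(arcLength.prod volume)) ^ 2 := by
        rw [mul_pow]
        congr 3
        ext z
        nth_rewrite 1 [← hsq z]
        ring
    _ ≤ C ^ 2 * ((∫⁻ z : UnitCircle × (ℝ × ℝ),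
          (‖𝓕 g₁ z.2.2‖ₑ * ‖𝓕 g₂ (z.2.1 - z.2.2)‖ₑ * bump z ^ (1 / 2 : ℝ)) ^ 2
            ∂(arcLength.prod volume)) *
          ∫⁻ z : UnitCircle × (ℝ × ℝ), (‖Ω z.1‖ₑ * ‖𝓕 g₃ z.2.1‖ₑ * bump z ^ (1 / 2 : ℝ)) ^ 2
            ∂(arcLength.prod volume)) := by gcongr
    _ = C ^ 2 * (∫⁻ z : UnitCircle × (ℝ × ℝ), ‖𝓕 g₁ z.2.2‖ₑ ^ 2 * ‖𝓕 g₂ (z.2.1 - z.2.2)‖ₑ ^ 2 *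
          bump z ∂(arcLength.prod volume)) *
          ∫⁻ z : UnitCircle × (ℝ × ℝ), ‖Ω z.1‖ₑ ^ 2 * ‖𝓕 g₃ z.2.1‖ₑ ^ 2 * bump z
            ∂(arcLength.prod volume) := by
        have e : ∀ z, (bump z ^ (1 / 2 : ℝ)) ^ 2 = bump z := fun z ↦ by rw [sq, hsq]
        simp only [mul_pow, e, mul_assoc]
    _ ≤ _ := by gcongr

/-- The localised estimate, with the gain in the first function. -/
theorem enorm_compensated_form_sq_le_left (hβ : ContDiff ℝ ∞ β) (hc : HasCompactSupport β)
    (hs : tsupport β ⊆ Set.Ioo (2⁻¹ : ℝ) 2)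
    (hC : ∀ τ : ℝ, |τ| ≤ 7 → ∀ ζ, ‖𝓕 (radialWeight β τ) ζ‖ₑ ≤ C * cauchyBump ζ)
    (m₁ : Measurable g₁) (m₂ : Measurable g₂)
    (m₃ : Measurable g₃) (i₁ : Integrable g₁) (h₁ : MemLp g₁ 2)
    (i₂ : Integrable g₂) (h₂ : MemLp g₂ 2) (i₃ : Integrable g₃) (h₃ : MemLp g₃ 2)
    (hm : Measurable Ω) (hM : ∀ θ, ‖Ω θ‖ₑ ≤ M) (hδ : 0 < δ)
    (hd : ∀ θ, Ω θ ≠ 0 → δ ≤ |(θ : Plane) 0 - (θ : Plane) 1|) :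
    ‖∫ y, ∫ x, compensatedKernel β Ω y * g₁ (x - y 0) * g₂ (x - y 1) * conj (g₃ x)‖ₑ ^ 2 ≤
      (C * ENNReal.ofReal (8 * Real.pi) * M) ^ 2 * ENNReal.ofReal δ⁻¹ *
        ((∫⁻ ξ, ENNReal.ofReal (1 + |ξ|)⁻¹ * ‖𝓕 g₁ ξ‖ₑ ^ 2) * (∫⁻ x, ‖g₂ x‖ₑ ^ 2) *
          ∫⁻ x, ‖g₃ x‖ₑ ^ 2) := by
  have c₁ := (Real.continuous_fourier_of_integrable i₁).measurable
  have c₂ := (Real.continuous_fourier_of_integrable i₂).measurable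
  have h := lintegral_circle_convolution_le_left (U := fun ξ ↦ ‖𝓕 g₁ ξ‖ₑ ^ 2)
    (V := fun ξ ↦ ‖𝓕 g₂ ξ‖ₑ ^ 2) (by fun_prop) (by fun_prop)
  rw [Real.lintegral_fourier_sq i₂ h₂] at h
  refine (enorm_compensated_form_sq_le hβ hc hs hC m₁ m₂ m₃ i₁ h₁ i₂ h₂ i₃ h₃ hm hM hδ hd).trans ?_
  refine (mul_le_mul_left (mul_le_mul_right h _) _).trans_eq ?_
  ring

/-- The localised estimate, with the gain in the second function. -/
theorem enorm_compensated_form_sq_le_right (hβ : ContDiff ℝ ∞ β) (hc : HasCompactSupport β)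
    (hs : tsupport β ⊆ Set.Ioo (2⁻¹ : ℝ) 2)
    (hC : ∀ τ : ℝ, |τ| ≤ 7 → ∀ ζ, ‖𝓕 (radialWeight β τ) ζ‖ₑ ≤ C * cauchyBump ζ)
    (m₁ : Measurable g₁) (m₂ : Measurable g₂)
    (m₃ : Measurable g₃) (i₁ : Integrable g₁) (h₁ : MemLp g₁ 2)
    (i₂ : Integrable g₂) (h₂ : MemLp g₂ 2) (i₃ : Integrable g₃) (h₃ : MemLp g₃ 2)
    (hm : Measurable Ω) (hM : ∀ θ, ‖Ω θ‖ₑ ≤ M) (hδ : 0 < δ)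
    (hd : ∀ θ, Ω θ ≠ 0 → δ ≤ |(θ : Plane) 0 - (θ : Plane) 1|) :
    ‖∫ y, ∫ x, compensatedKernel β Ω y * g₁ (x - y 0) * g₂ (x - y 1) * conj (g₃ x)‖ₑ ^ 2 ≤
      (C * ENNReal.ofReal (8 * Real.pi) * M) ^ 2 * ENNReal.ofReal δ⁻¹ *
        ((∫⁻ ξ, ENNReal.ofReal (1 + |ξ|)⁻¹ * ‖𝓕 g₂ ξ‖ₑ ^ 2) * (∫⁻ x, ‖g₁ x‖ₑ ^ 2) *
          ∫⁻ x, ‖g₃ x‖ₑ ^ 2) := by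
  have c₁ := (Real.continuous_fourier_of_integrable i₁).measurable
  have c₂ := (Real.continuous_fourier_of_integrable i₂).measurable
  have h := lintegral_circle_convolution_le_right (U := fun ξ ↦ ‖𝓕 g₁ ξ‖ₑ ^ 2)
    (V := fun ξ ↦ ‖𝓕 g₂ ξ‖ₑ ^ 2) (by fun_prop) (by fun_prop)
  rw [Real.lintegral_fourier_sq i₁ h₁] at h
  refine (enorm_compensated_form_sq_le hβ hc hs hC m₁ m₂ m₃ i₁ h₁ i₂ h₂ i₃ h₃ hm hM hδ hd).trans ?_
  refine (mul_le_mul_left (mul_le_mul_right h _) _).trans_eq ?_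
  ring

end Local

/-! ### The trilinear form and its size estimate -/

/-- The integrand of the trilinear form with kernel `K`. -/
noncomputable def triIntegrand (K : Plane → ℂ) (f : Fin 3 → ℝ → ℂ) (p : Plane × ℝ) : ℂ :=
  K p.1 * f 0 (p.2 - p.1 0) * f 1 (p.2 - p.1 1) * conj (f 2 p.2)

theorem measurable_triIntegrand {K : Plane → ℂ} {f : Fin 3 → ℝ → ℂ} (hK : Measurable K)
    (hf : ∀ i, Measurable (f i)) : Measurable (triIntegrand K f) := by
  have h0 := hf 0
  have h1 := hf 1
  have h2 := hf 2
  have hc := Complex.continuous_conj.measurable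
  unfold triIntegrand
  fun_prop

theorem lintegral_prod_translates_le {f : Fin 3 → ℝ → ℂ} (hf : ∀ i, Measurable (f i))
    (l : Equiv.Perm (Fin 3)) (a : Fin 3 → ℝ) :
    ∫⁻ x, ∏ i, ‖f i (x - a i)‖ₑ ≤
      eLpNorm (f (l 0)) 2 volume * eLpNorm (f (l 1)) 2 volume * eLpNorm (f (l 2)) ⊤ volume := by
  have h2 : ∀ᵐ x, ‖f (l 2) (x - a (l 2))‖ₑ ≤ eLpNorm (f (l 2)) ⊤ volume := by
    have := ae_le_eLpNormEssSup (f := f (l 2)) (μ := (volume : Measure ℝ))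
    rw [← eLpNorm_exponent_top] at this
    exact (measurePreserving_sub_right volume (a (l 2))).quasiMeasurePreserving.ae this
  calc ∫⁻ x, ∏ i, ‖f i (x - a i)‖ₑ
      = ∫⁻ x, ‖f (l 0) (x - a (l 0))‖ₑ * ‖f (l 1) (x - a (l 1))‖ₑ * ‖f (l 2) (x - a (l 2))‖ₑ := by
        refine lintegral_congr fun x ↦ ?_
        rw [← Equiv.prod_comp l, Fin.prod_univ_three]
    _ ≤ ∫⁻ x, ‖f (l 0) (x - a (l 0))‖ₑ * ‖f (l 1) (x - a (l 1))‖ₑ *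
          eLpNorm (f (l 2)) ⊤ volume := by
        refine lintegral_mono_ae ?_
        filter_upwards [h2] with x hx
        gcongr
    _ = (∫⁻ x, ‖f (l 0) (x - a (l 0))‖ₑ * ‖f (l 1) (x - a (l 1))‖ₑ) *
          eLpNorm (f (l 2)) ⊤ volume := by
        have m0 := hf (l 0)
        have m1 := hf (l 1)
        rw [lintegral_mul_const _ (by fun_prop)]
    _ ≤ _ := by
        gcongr
        have m0 := hf (l 0)
        have m1 := hf (l 1)
        have cs := ENNReal.sq_lintegral_mul_le (μ := volume)
          (f := fun x ↦ ‖f (l 0) (x - a (l 0))‖ₑ) (g := fun x ↦ ‖f (l 1) (x - a (l 1))‖ₑ)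
          (by fun_prop) (by fun_prop)
        rw [lintegral_sub_right_eq_self (fun x ↦ ‖f (l 0) x‖ₑ ^ 2),
          lintegral_sub_right_eq_self (fun x ↦ ‖f (l 1) x‖ₑ ^ 2), ← eLpNorm_two_sq,
          ← eLpNorm_two_sq, ← mul_pow] at cs
        exact (ENNReal.pow_le_pow_left_iff two_ne_zero).mp cs

/-- The size estimate: translation invariance reduces it to Hölder's inequality for fixed `y`. -/
theorem lintegral_triIntegrand_le {K : Plane → ℂ} {f : Fin 3 → ℝ → ℂ} (hK : Measurable K)
    (hf : ∀ i, Measurable (f i)) (l : Equiv.Perm (Fin 3)) :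
    ∫⁻ p, ‖triIntegrand K f p‖ₑ ≤ (∫⁻ y, ‖K y‖ₑ) *
      (eLpNorm (f (l 0)) 2 volume * eLpNorm (f (l 1)) 2 volume *
        eLpNorm (f (l 2)) ⊤ volume) := by
  rw [Measure.volume_eq_prod, lintegral_prod _ (measurable_triIntegrand hK hf).enorm.aemeasurable,
    ← lintegral_mul_const _ hK.enorm]
  refine lintegral_mono fun y ↦ ?_
  calc ∫⁻ x, ‖triIntegrand K f (y, x)‖ₑ
      = ∫⁻ x, ‖K y‖ₑ * ∏ i, ‖f i (x - ![y 0, y 1, 0] i)‖ₑ := by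
        refine lintegral_congr fun x ↦ ?_
        simp only [triIntegrand, enorm_mul, RCLike.enorm_conj, Fin.prod_univ_three,
          Matrix.cons_val_zero, Matrix.cons_val_one, Matrix.cons_val, sub_zero]
        ring
    _ = ‖K y‖ₑ * ∫⁻ x, ∏ i, ‖f i (x - ![y 0, y 1, 0] i)‖ₑ := by
        rw [lintegral_const_mul' _ _ enorm_ne_top]
    _ ≤ _ := by
        gcongr
        exact lintegral_prod_translates_le hf l _

theorem integrable_triIntegrand {K : Plane → ℂ} {f : Fin 3 → ℝ → ℂ} (hK : Measurable K)
    (hK1 : ∫⁻ y, ‖K y‖ₑ < ⊤) (hf : ∀ i, Measurable (f i)) (l : Equiv.Perm (Fin 3))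
    (h₀ : MemLp (f (l 0)) 2) (h₁ : MemLp (f (l 1)) 2) (h₂ : MemLp (f (l 2)) ⊤) :
    Integrable (triIntegrand K f) := by
  refine ⟨(measurable_triIntegrand hK hf).aestronglyMeasurable, ?_⟩
  rw [hasFiniteIntegral_iff_enorm]
  exact (lintegral_triIntegrand_le hK hf l).trans_lt
    (ENNReal.mul_lt_top hK1 (ENNReal.mul_lt_top (ENNReal.mul_lt_top h₀.2 h₁.2) h₂.2))

/-! ### Localisation to Gaussian windows -/

theorem integral_three_gaussWindow (x a b : ℝ) :
    ∫ s, gaussWindow (x - a - s) * gaussWindow (x - b - s) * gaussWindow (x - s) =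
      (√3 * Real.exp (2 * Real.pi / 3 * (a ^ 2 + b ^ 2 - a * b)))⁻¹ := by
  have e : ∀ s, gaussWindow (x - a - s) * gaussWindow (x - b - s) * gaussWindow (x - s) =
      Real.exp (-(2 * Real.pi / 3 * (a ^ 2 + b ^ 2 - a * b))) *
        Real.exp (-(3 * Real.pi) * (s - (x - (a + b) / 3)) ^ 2) := by
    intro s
    rw [gaussWindow, gaussWindow, gaussWindow, ← Real.exp_add, ← Real.exp_add, ← Real.exp_add]
    congr 1
    ring
  simp only [e]
  rw [integral_const_mul, integral_sub_right_eq_self (fun s ↦ Real.exp (-(3 * Real.pi) * s ^ 2)),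
    integral_gaussian, Real.exp_neg, mul_inv, mul_comm]
  congr 1
  rw [← Real.sqrt_inv]
  congr 1
  field_simp

theorem integrable_three_gaussWindow (x a b : ℝ) :
    Integrable fun s ↦ gaussWindow (x - a - s) * gaussWindow (x - b - s) * gaussWindow (x - s) := by
  refine (integrable_gaussWindow.comp_sub_left x).mono (by fun_prop)
    (Filter.Eventually.of_forall fun s ↦ ?_)
  have h0 := gaussWindow_pos (x - s)
  have h1 := gaussWindow_pos (x - a - s)
  have h2 := gaussWindow_pos (x - b - s)
  rw [Real.norm_of_nonneg (by positivity), Real.norm_of_nonneg h0.le]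
  exact mul_le_of_le_one_left h0.le
    (mul_le_one₀ (gaussWindow_le_one _) h2.le (gaussWindow_le_one _))

theorem triIntegrand_windowed (β : ℝ → ℂ) (Ω : UnitCircle → ℂ) (f : Fin 3 → ℝ → ℂ)
    (p : Plane × ℝ) (s : ℝ) :
    triIntegrand (compensatedKernel β Ω) (fun i ↦ windowed (f i) s) p =
      triIntegrand (singleScaleKernel β Ω) f p *
        ((√3 * Real.exp (2 * Real.pi / 3 * (p.1 0 ^ 2 + p.1 1 ^ 2 - p.1 0 * p.1 1)) : ℝ) : ℂ) *
        ((gaussWindow (p.2 - p.1 0 - s) * gaussWindow (p.2 - p.1 1 - s) *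
          gaussWindow (p.2 - s) : ℝ) : ℂ) := by
  simp only [triIntegrand, compensatedKernel, windowed, map_mul, Complex.conj_ofReal]
  push_cast
  ring

/-- Gaussian windows reproduce the trilinear form from its localisations. -/
theorem integral_windowed_triIntegrand (β : ℝ → ℂ) (Ω : UnitCircle → ℂ) (f : Fin 3 → ℝ → ℂ)
    (p : Plane × ℝ) :
    ∫ s, triIntegrand (compensatedKernel β Ω) (fun i ↦ windowed (f i) s) p =
      triIntegrand (singleScaleKernel β Ω) f p := by
  simp only [triIntegrand_windowed]
  rw [integral_const_mul, integral_complex_ofReal, integral_three_gaussWindow, mul_assoc,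
    ← Complex.ofReal_mul, mul_inv_cancel₀ (by positivity), Complex.ofReal_one, mul_one]

theorem lintegral_windowed_triIntegrand (β : ℝ → ℂ) (Ω : UnitCircle → ℂ) (f : Fin 3 → ℝ → ℂ)
    (p : Plane × ℝ) :
    ∫⁻ s, ‖triIntegrand (compensatedKernel β Ω) (fun i ↦ windowed (f i) s) p‖ₑ =
      ‖triIntegrand (singleScaleKernel β Ω) f p‖ₑ := by
  have hr : ∀ t : ℝ, 0 ≤ t → ‖(t : ℂ)‖ₑ = ENNReal.ofReal t := fun t ht ↦ by
    rw [← ofReal_norm, Complex.norm_real, Real.norm_of_nonneg ht]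
  have hg : ∀ s, 0 ≤ gaussWindow (p.2 - p.1 0 - s) * gaussWindow (p.2 - p.1 1 - s) *
      gaussWindow (p.2 - s) := fun s ↦
    mul_nonneg (mul_nonneg (gaussWindow_pos _).le (gaussWindow_pos _).le) (gaussWindow_pos _).le
  simp only [triIntegrand_windowed, enorm_mul _ ((_ : ℝ) : ℂ)]
  rw [lintegral_const_mul' _ _ (by finiteness)]
  simp only [hr _ (hg _)]
  rw [← ofReal_integral_eq_lintegral_ofReal (integrable_three_gaussWindow _ _ _)
    (Filter.Eventually.of_forall hg), integral_three_gaussWindow, hr _ (by positivity), mul_assoc,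
    ← ENNReal.ofReal_mul (by positivity), mul_inv_cancel₀ (by positivity), ENNReal.ofReal_one,
    mul_one]

theorem measurable_windowed {f : ℝ → ℂ} (hf : Measurable f) :
    Measurable fun p : ℝ × ℝ ↦ windowed f p.1 p.2 := by
  unfold windowed
  fun_prop

/-- Fubini's theorem moves the integral over the centres of the windows outside. -/
theorem enorm_integral_triIntegrand_le_windowed {β : ℝ → ℂ} {Ω : UnitCircle → ℂ}
    {f : Fin 3 → ℝ → ℂ} (hβ : Measurable β) (hΩ : Measurable Ω) (hf : ∀ i, Measurable (f i))
    (hi : Integrable (triIntegrand (singleScaleKernel β Ω) f)) :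
    ‖∫ p, triIntegrand (singleScaleKernel β Ω) f p‖ₑ ≤
      ∫⁻ s, ‖∫ y, ∫ x, compensatedKernel β Ω y * windowed (f 0) s (x - y 0) *
        windowed (f 1) s (x - y 1) * conj (windowed (f 2) s x)‖ₑ := by
  have hm : Measurable fun z : ℝ × (Plane × ℝ) ↦
      triIntegrand (compensatedKernel β Ω) (fun i ↦ windowed (f i) z.1) z.2 := by
    have h0 := measurable_windowed (hf 0)
    have h1 := measurable_windowed (hf 1)
    have h2 := measurable_windowed (hf 2)
    have hK := measurable_compensatedKernel hβ hΩ
    have hc := Complex.continuous_conj.measurable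
    unfold triIntegrand
    fun_prop
  have hint : Integrable (fun z : ℝ × (Plane × ℝ) ↦
      triIntegrand (compensatedKernel β Ω) (fun i ↦ windowed (f i) z.1) z.2) := by
    refine ⟨hm.aestronglyMeasurable, ?_⟩
    rw [hasFiniteIntegral_iff_enorm, Measure.volume_eq_prod, lintegral_prod_symm _
      hm.enorm.aemeasurable]
    simp only [lintegral_windowed_triIntegrand]
    exact hasFiniteIntegral_iff_enorm.mp hi.2
  have hswap : ∫ p, triIntegrand (singleScaleKernel β Ω) f p =
      ∫ s, ∫ p, triIntegrand (compensatedKernel β Ω) (fun i ↦ windowed (f i) s) p := by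
    rw [integral_integral_swap hint]
    simp only [integral_windowed_triIntegrand]
  rw [hswap]
  refine (enorm_integral_le_lintegral_enorm _).trans (lintegral_mono_ae ?_)
  filter_upwards [hint.prod_right_ae] with s hs
  rw [Measure.volume_eq_prod, integral_prod _ hs]
  rfl

/-! ### The estimate for bounded angular parts -/

theorem ENNReal.sq_lintegral_le_of_sq_le {D N J : ℝ → ℝ≥0∞} {c : ℝ≥0∞} (hN : Measurable N)
    (hJ : Measurable J) (h : ∀ s, D s ^ 2 ≤ c * (N s * J s)) :
    (∫⁻ s, D s) ^ 2 ≤ c * ((∫⁻ s, N s) * ∫⁻ s, J s) := by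
  have hsq : ∀ x : ℝ≥0∞, (x ^ (1 / 2 : ℝ)) ^ 2 = x := fun x ↦ by
    rw [← ENNReal.rpow_natCast, ← ENNReal.rpow_mul]; norm_num
  have cs := ENNReal.sq_lintegral_mul_le (μ := (volume : Measure ℝ))
    (f := fun s ↦ N s ^ (1 / 2 : ℝ)) (g := fun s ↦ J s ^ (1 / 2 : ℝ)) (by fun_prop) (by fun_prop)
  simp only [hsq] at cs
  calc (∫⁻ s, D s) ^ 2 ≤ (∫⁻ s, c ^ (1 / 2 : ℝ) * (N s ^ (1 / 2 : ℝ) * J s ^ (1 / 2 : ℝ))) ^ 2 := by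
        gcongr with s
        refine (ENNReal.pow_le_pow_left_iff two_ne_zero).mp ((h s).trans_eq ?_)
        simp only [mul_pow, hsq]
    _ = c * (∫⁻ s, N s ^ (1 / 2 : ℝ) * J s ^ (1 / 2 : ℝ)) ^ 2 := by
        rw [lintegral_const_mul _ (by fun_prop), mul_pow, hsq]
    _ ≤ _ := by gcongr

theorem lintegral_windowed_sq_le {f : ℝ → ℂ} (hf : Measurable f) :
    ∫⁻ s, ∫⁻ x, ‖windowed f s x‖ₑ ^ 2 ≤ eLpNorm f 2 volume ^ 2 := by
  have hm := measurable_windowed hf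
  rw [lintegral_lintegral_swap (by unfold Function.uncurry; fun_prop), eLpNorm_two_sq]
  refine lintegral_mono fun x ↦ ?_
  simp only [windowed, enorm_mul, mul_pow]
  rw [lintegral_const_mul _ (by fun_prop)]
  refine mul_le_of_le_one_right' ?_
  rw [lintegral_sub_left_eq_self (fun s ↦ ‖(gaussWindow s : ℂ)‖ₑ ^ 2) x]
  simpa using lintegral_gaussWindow_sq_le 0

theorem lintegral_windowed_sq_le_top (f : ℝ → ℂ) (s : ℝ) :
    ∫⁻ x, ‖windowed f s x‖ₑ ^ 2 ≤ eLpNorm f ⊤ volume ^ 2 := by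
  have h2 : ∀ᵐ x, ‖f x‖ₑ ≤ eLpNorm f ⊤ volume := by
    rw [eLpNorm_exponent_top]
    exact ae_le_eLpNormEssSup
  calc ∫⁻ x, ‖windowed f s x‖ₑ ^ 2
      ≤ ∫⁻ x, eLpNorm f ⊤ volume ^ 2 * ‖(gaussWindow (x - s) : ℂ)‖ₑ ^ 2 := by
        refine lintegral_mono_ae ?_
        filter_upwards [h2] with x hx
        rw [windowed, enorm_mul, mul_pow]
        gcongr
    _ = eLpNorm f ⊤ volume ^ 2 * ∫⁻ x, ‖(gaussWindow (x - s) : ℂ)‖ₑ ^ 2 :=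
        lintegral_const_mul _ (by fun_prop)
    _ ≤ _ := mul_le_of_le_one_right' (lintegral_gaussWindow_sq_le s)

/-- The smoothing estimate for bounded angular parts supported away from the diagonal directions.
The frequency gain comes from the input `f i`, where `i` is one of the two inputs of the bilinear
operator. -/
theorem enorm_integral_triIntegrand_sq_le {β : ℝ → ℂ} {Ω : UnitCircle → ℂ}
    {f : Fin 3 → ℝ → ℂ} {C M : ℝ≥0∞} {δ lam : ℝ} (hβ : ContDiff ℝ ∞ β) (hc : HasCompactSupport β)
    (hs : tsupport β ⊆ Set.Ioo (2⁻¹ : ℝ) 2)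
    (hC : ∀ τ : ℝ, |τ| ≤ 7 → ∀ ζ, ‖𝓕 (radialWeight β τ) ζ‖ₑ ≤ C * cauchyBump ζ)
    (hm : Measurable Ω) (hM : ∀ θ, ‖Ω θ‖ₑ ≤ M) (hδ : 0 < δ)
    (hd : ∀ θ, Ω θ ≠ 0 → δ ≤ |(θ : Plane) 0 - (θ : Plane) 1|)
    (hf : ∀ i, Measurable (f i)) (hi : Integrable (triIntegrand (singleScaleKernel β Ω) f))
    {i j k : Fin 3}
    (hijk : (i = 0 ∧ j = 1 ∧ k = 2) ∨ (i = 0 ∧ j = 2 ∧ k = 1) ∨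
      (i = 1 ∧ j = 0 ∧ k = 2) ∨ (i = 1 ∧ j = 2 ∧ k = 0))
    (h₀ : MemLp (f i) 2) (h₁ : MemLp (f j) 2) (h₂ : MemLp (f k) ⊤) (hlam : 0 < lam)
    (hF : ∀ᵐ ξ, |ξ| < lam → (𝓕 (h₀.toLp (f i)) : Lp ℂ 2 (volume : Measure ℝ)) ξ = 0) :
    ‖∫ p, triIntegrand (singleScaleKernel β Ω) f p‖ₑ ^ 2 ≤
      (C * ENNReal.ofReal (8 * Real.pi) * M) ^ 2 * ENNReal.ofReal δ⁻¹ *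
        (2 * ENNReal.ofReal lam⁻¹) *
        (eLpNorm (f i) 2 volume * eLpNorm (f j) 2 volume * eLpNorm (f k) ⊤ volume) ^ 2 := by
  set A := (C * ENNReal.ofReal (8 * Real.pi) * M) ^ 2 * ENNReal.ofReal δ⁻¹ with hA
  have mw : ∀ (n : Fin 3) (s : ℝ), Measurable (windowed (f n) s) := fun n s ↦
    (measurable_windowed (hf n)).comp measurable_prodMk_left
  have hloc : ∀ s, ‖∫ y, ∫ x, compensatedKernel β Ω y * windowed (f 0) s (x - y 0) *
        windowed (f 1) s (x - y 1) * conj (windowed (f 2) s x)‖ₑ ^ 2 ≤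
      A * ((∫⁻ ξ, ENNReal.ofReal (1 + |ξ|)⁻¹ * ‖𝓕 (windowed (f i) s) ξ‖ₑ ^ 2) *
        (∫⁻ x, ‖windowed (f j) s x‖ₑ ^ 2) * ∫⁻ x, ‖windowed (f k) s x‖ₑ ^ 2) := by
    intro s
    have i₀ := h₀.windowed_integrable s
    have l₀ := h₀.windowed_memLp s
    have i₁ := h₁.windowed_integrable s
    have l₁ := h₁.windowed_memLp s
    have i₂ := h₂.windowed_integrable_of_top s
    have l₂ := h₂.windowed_memLp_of_top s
    have m0 := mw 0 s
    have m1 := mw 1 s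
    have m2 := mw 2 s
    rcases hijk with ⟨rfl, rfl, rfl⟩ | ⟨rfl, rfl, rfl⟩ | ⟨rfl, rfl, rfl⟩ | ⟨rfl, rfl, rfl⟩
    · exact enorm_compensated_form_sq_le_left hβ hc hs hC m0 m1 m2 i₀ l₀ i₁ l₁ i₂ l₂ hm hM hδ hd
    · refine (enorm_compensated_form_sq_le_left hβ hc hs hC m0 m1 m2 i₀ l₀ i₂ l₂ i₁ l₁ hm hM hδ
        hd).trans_eq ?_
      rw [mul_right_comm (∫⁻ ξ, _) (∫⁻ x, _) (∫⁻ x, _)]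
    · exact enorm_compensated_form_sq_le_right hβ hc hs hC m0 m1 m2 i₁ l₁ i₀ l₀ i₂ l₂ hm hM hδ hd
    · refine (enorm_compensated_form_sq_le_right hβ hc hs hC m0 m1 m2 i₂ l₂ i₀ l₀ i₁ l₁ hm hM hδ
        hd).trans_eq ?_
      rw [mul_right_comm (∫⁻ ξ, _) (∫⁻ x, _) (∫⁻ x, _)]
  have mF := measurable_fourier_windowed (hf i)
  have mj := measurable_windowed (hf j)
  have mN : Measurable fun s ↦
      ∫⁻ ξ, ENNReal.ofReal (1 + |ξ|)⁻¹ * ‖𝓕 (windowed (f i) s) ξ‖ₑ ^ 2 :=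
    Measurable.lintegral_prod_right (by unfold Function.uncurry; fun_prop)
  have mJ : Measurable fun s ↦ ∫⁻ x, ‖windowed (f j) s x‖ₑ ^ 2 :=
    Measurable.lintegral_prod_right (by unfold Function.uncurry; fun_prop)
  have key := ENNReal.sq_lintegral_le_of_sq_le (c := A * eLpNorm (f k) ⊤ volume ^ 2) mN mJ
    fun s ↦ (hloc s).trans (by
      rw [mul_assoc A, mul_comm (eLpNorm (f k) ⊤ volume ^ 2)]
      gcongr
      exact lintegral_windowed_sq_le_top (f k) s)
  calc _ ≤ (∫⁻ s, ‖∫ y, ∫ x, compensatedKernel β Ω y * windowed (f 0) s (x - y 0) *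
        windowed (f 1) s (x - y 1) * conj (windowed (f 2) s x)‖ₑ) ^ 2 := by
        gcongr
        exact enorm_integral_triIntegrand_le_windowed hβ.continuous.measurable hm hf hi
    _ ≤ _ := key
    _ ≤ A * eLpNorm (f k) ⊤ volume ^ 2 * ((2 * ENNReal.ofReal lam⁻¹ *
          eLpNorm (f i) 2 volume ^ 2) * eLpNorm (f j) 2 volume ^ 2) := by
        gcongr
        · rw [eLpNorm_two_sq]
          exact lintegral_fourier_windowed_le h₀ hlam hF
        · exact lintegral_windowed_sq_le (hf j)
    _ = _ := by ring

/-! ### Splitting the angular part -/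

/-- The directions where `Ω` is large compared with its `L^q` norm, or which are close to the
diagonal. -/
def exceptionalSet (Ω : UnitCircle → ℂ) (q : ℝ≥0∞) (t : ℝ) : Set UnitCircle :=
  {θ | ¬(‖Ω θ‖ₑ ≤ eLpNorm Ω q arcLength * ENNReal.ofReal t ∧
    t⁻¹ ≤ |(θ : Plane) 0 - (θ : Plane) 1|)}

section Splitting

variable {Ω : UnitCircle → ℂ} {q : ℝ≥0∞} {t : ℝ}

theorem measurableSet_exceptionalSet (hΩ : Measurable Ω) :
    MeasurableSet (exceptionalSet Ω q t) := by
  refine MeasurableSet.compl (MeasurableSet.inter ?_ ?_)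
  · exact measurableSet_le hΩ.enorm measurable_const
  · exact measurableSet_le (f := fun _ ↦ t⁻¹)
      (g := fun θ : UnitCircle ↦ |(θ : Plane) 0 - (θ : Plane) 1|) measurable_const (by fun_prop)

theorem one_div_toReal_nonneg_lt_one (hq : 1 < q) : 0 ≤ 1 / q.toReal ∧ 1 / q.toReal < 1 := by
  refine ⟨by positivity, ?_⟩
  by_cases h : q = ⊤
  · simp [h]
  · have : 1 < q.toReal := by
      rw [← ENNReal.toReal_one]
      exact (ENNReal.toReal_lt_toReal ENNReal.one_ne_top h).mpr hq
    rw [div_lt_one (by linarith)]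
    exact this

theorem lintegral_enorm_le_eLpNorm (hΩ : Measurable Ω) (hq : 1 < q) :
    ∫⁻ θ, ‖Ω θ‖ₑ ∂arcLength ≤ 8 * eLpNorm Ω q arcLength := by
  have h := eLpNorm_le_eLpNorm_mul_rpow_measure_univ (μ := arcLength) hq.le
    hΩ.aestronglyMeasurable
  rw [eLpNorm_one_eq_lintegral_enorm, ENNReal.toReal_one, div_one] at h
  obtain ⟨h0, h1⟩ := one_div_toReal_nonneg_lt_one hq
  calc _ ≤ eLpNorm Ω q arcLength * (arcLength Set.univ) ^ (1 - 1 / q.toReal) := h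
    _ ≤ eLpNorm Ω q arcLength * 8 ^ (1 - 1 / q.toReal) := by
        gcongr
        exact arcLength_univ_le
    _ ≤ eLpNorm Ω q arcLength * 8 ^ (1 : ℝ) := by
        gcongr
        · norm_num
        · linarith
    _ = _ := by rw [ENNReal.rpow_one, mul_comm]

/-- Chebyshev's inequality for the size of `Ω`, and the length of the arcs near the diagonal. -/
theorem arcLength_exceptionalSet_le (hΩ : Measurable Ω) (hq : 1 < q) (ht : 1 ≤ t)
    (hN : eLpNorm Ω q arcLength ≠ ⊤) :
    arcLength (exceptionalSet Ω q t) ≤ 16 * ENNReal.ofReal t⁻¹ := by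
  set N := eLpNorm Ω q arcLength with hNdef
  have ht0 : 0 < t := by linarith
  have hT : ENNReal.ofReal t ≠ 0 := by simpa using ht0
  have hsub : exceptionalSet Ω q t ⊆ {θ | N * ENNReal.ofReal t < ‖Ω θ‖ₑ} ∪
      {θ | |(θ : Plane) 0 - (θ : Plane) 1| < t⁻¹} := by
    intro θ hθ
    simp only [exceptionalSet, Set.mem_ofPred_eq, not_and_or, not_le] at hθ
    exact hθ
  have hlarge : arcLength {θ | N * ENNReal.ofReal t < ‖Ω θ‖ₑ} ≤ 8 * ENNReal.ofReal t⁻¹ := by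
    by_cases h0 : N = 0
    · have hz := (eLpNorm_eq_zero_iff hΩ.aestronglyMeasurable (by
        rintro rfl; simp at hq)).mp h0
      have : arcLength {θ | N * ENNReal.ofReal t < ‖Ω θ‖ₑ} = 0 := by
        refine measure_mono_null ?_ (ae_iff.mp hz)
        intro θ hθ
        simp only [h0, zero_mul, Set.mem_ofPred_eq, Pi.zero_apply] at hθ ⊢
        simpa using hθ.ne'
      rw [this]
      exact zero_le
    · have h1 := mul_meas_ge_le_lintegral₀ (μ := arcLength) hΩ.enorm.aemeasurable
        (N * ENNReal.ofReal t)
      have h2 := h1.trans (lintegral_enorm_le_eLpNorm hΩ hq)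
      rw [← hNdef, mul_assoc, mul_comm 8 N, ENNReal.mul_le_mul_iff_right h0 hN, mul_comm] at h2
      rw [ENNReal.ofReal_inv_of_pos ht0, ← div_eq_mul_inv,
        ENNReal.le_div_iff_mul_le (Or.inl hT) (Or.inl ENNReal.ofReal_ne_top)]
      refine (mul_le_mul_left ?_ _).trans h2
      refine measure_mono fun θ hθ ↦ ?_
      exact (show N * ENNReal.ofReal t < ‖Ω θ‖ₑ from hθ).le
  calc _ ≤ 8 * ENNReal.ofReal t⁻¹ + 8 * ENNReal.ofReal t⁻¹ :=
        (measure_mono hsub).trans ((measure_union_le _ _).trans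
          (add_le_add hlarge (arcLength_near_diagonal_le _)))
    _ = _ := by rw [← add_mul]; norm_num

/-- Hölder's inequality on the exceptional set; this is where `q > 1` gives a gain. -/
theorem setLIntegral_exceptionalSet_le (hΩ : Measurable Ω) (hq : 1 < q) (ht : 1 ≤ t)
    (hN : eLpNorm Ω q arcLength ≠ ⊤) :
    ∫⁻ θ, ‖(exceptionalSet Ω q t).indicator Ω θ‖ₑ ∂arcLength ≤
      16 * eLpNorm Ω q arcLength * ENNReal.ofReal t⁻¹ ^ (1 - 1 / q.toReal) := by
  obtain ⟨h0, h1⟩ := one_div_toReal_nonneg_lt_one hq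
  have h := eLpNorm_le_eLpNorm_mul_rpow_measure_univ
    (μ := arcLength.restrict (exceptionalSet Ω q t)) hq.le hΩ.aestronglyMeasurable
  rw [eLpNorm_one_eq_lintegral_enorm, ENNReal.toReal_one, div_one,
    Measure.restrict_apply_univ] at h
  simp only [enorm_indicator_eq_indicator_enorm]
  rw [lintegral_indicator (measurableSet_exceptionalSet hΩ)]
  calc _ ≤ _ := h
    _ ≤ eLpNorm Ω q arcLength * (16 * ENNReal.ofReal t⁻¹) ^ (1 - 1 / q.toReal) := by
        gcongr
        · exact Measure.restrict_le_self
        · exact arcLength_exceptionalSet_le hΩ hq ht hN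
    _ ≤ eLpNorm Ω q arcLength * (16 * ENNReal.ofReal t⁻¹ ^ (1 - 1 / q.toReal)) := by
        rw [ENNReal.mul_rpow_of_nonneg _ _ (by linarith)]
        gcongr
        calc (16 : ℝ≥0∞) ^ (1 - 1 / q.toReal) ≤ 16 ^ (1 : ℝ) := by
              gcongr
              · norm_num
              · linarith
          _ = 16 := ENNReal.rpow_one _
    _ = _ := by ring

end Splitting

theorem exists_perm_fin_three {i j k : Fin 3}
    (hijk : (i = 0 ∧ j = 1 ∧ k = 2) ∨ (i = 0 ∧ j = 2 ∧ k = 1) ∨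
      (i = 1 ∧ j = 0 ∧ k = 2) ∨ (i = 1 ∧ j = 2 ∧ k = 0)) :
    ∃ l : Equiv.Perm (Fin 3), l 0 = i ∧ l 1 = j ∧ l 2 = k := by
  revert i j k
  decide

/-- The smoothing inequality for measurable data, the frequency gain coming from the input `f i`.
The parameter `t` is the cut-off for the size of `Ω` and for the distance to the diagonal. -/
theorem enorm_integral_triIntegrand_le {β : ℝ → ℂ} {Ω : UnitCircle → ℂ} {q : ℝ≥0∞}
    {f : Fin 3 → ℝ → ℂ} {C : ℝ≥0∞} {t : ℝ} (hβ : ContDiff ℝ ∞ β) (hc : HasCompactSupport β)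
    (hs : tsupport β ⊆ Set.Ioo (2⁻¹ : ℝ) 2)
    (hC : ∀ τ : ℝ, |τ| ≤ 7 → ∀ ζ, ‖𝓕 (radialWeight β τ) ζ‖ₑ ≤ C * cauchyBump ζ)
    (hq : 1 < q) (hm : Measurable Ω) (hΩ : MemLp Ω q arcLength) (ht : 1 ≤ t)
    (hf : ∀ i, Measurable (f i)) {i j k : Fin 3}
    (hijk : (i = 0 ∧ j = 1 ∧ k = 2) ∨ (i = 0 ∧ j = 2 ∧ k = 1) ∨
      (i = 1 ∧ j = 0 ∧ k = 2) ∨ (i = 1 ∧ j = 2 ∧ k = 0))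
    (h₀ : MemLp (f i) 2) (h₁ : MemLp (f j) 2) (h₂ : MemLp (f k) ⊤)
    (hF : ∀ᵐ ξ, |ξ| < t ^ 6 → (𝓕 (h₀.toLp (f i)) : Lp ℂ 2 (volume : Measure ℝ)) ξ = 0) :
    ‖∫ p, triIntegrand (singleScaleKernel β Ω) f p‖ₑ ≤
      16 * ((∫⁻ r in Set.Ioi (0 : ℝ), ‖β r / r‖ₑ) + C * ENNReal.ofReal (8 * Real.pi)) *
        ENNReal.ofReal t⁻¹ ^ (1 - 1 / q.toReal) * eLpNorm Ω q arcLength *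
        (eLpNorm (f i) 2 volume * eLpNorm (f j) 2 volume *
          eLpNorm (f k) ⊤ volume) := by
  obtain ⟨l, rfl, rfl, rfl⟩ := exists_perm_fin_three hijk
  obtain ⟨hq0, hq1⟩ := one_div_toReal_nonneg_lt_one hq
  set N := eLpNorm Ω q arcLength with hN
  set P := eLpNorm (f (l 0)) 2 volume * eLpNorm (f (l 1)) 2 volume *
    eLpNorm (f (l 2)) ⊤ volume with hP
  set u := ENNReal.ofReal t⁻¹ with hu
  set R := ∫⁻ r in Set.Ioi (0 : ℝ), ‖β r / r‖ₑ with hR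
  have ht0 : 0 < t := by linarith
  have hNt : N ≠ ⊤ := hΩ.2.ne
  have hRt : R < ⊤ := lintegral_radial_lt_top hβ hc hs
  set E := exceptionalSet Ω q t with hE
  have hEm : MeasurableSet E := measurableSet_exceptionalSet hm
  have hβm := hβ.continuous.measurable
  have mb : Measurable (E.indicator Ω) := hm.indicator hEm
  have mg : Measurable (Eᶜ.indicator Ω) := hm.indicator hEm.compl
  have hL1 : ∫⁻ θ, ‖Ω θ‖ₑ ∂arcLength < ⊤ :=
    (lintegral_enorm_le_eLpNorm hm hq).trans_lt (ENNReal.mul_lt_top (by simp) hΩ.2)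
  have hKfin : ∀ A : Set UnitCircle, MeasurableSet A →
      ∫⁻ y, ‖singleScaleKernel β (A.indicator Ω) y‖ₑ < ⊤ := by
    intro A hA
    rw [lintegral_singleScaleKernel hβm (hm.indicator hA)]
    refine ENNReal.mul_lt_top (lt_of_le_of_lt (lintegral_mono fun θ ↦ ?_) hL1) hRt
    exact enorm_indicator_le_enorm_self _ _
  have ib := integrable_triIntegrand (measurable_singleScaleKernel hβm mb) (hKfin E hEm) hf l
    h₀ h₁ h₂
  have ig := integrable_triIntegrand (measurable_singleScaleKernel hβm mg) (hKfin Eᶜ hEm.compl)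
    hf l h₀ h₁ h₂
  have hsplit : ∫ p, triIntegrand (singleScaleKernel β Ω) f p =
      (∫ p, triIntegrand (singleScaleKernel β (E.indicator Ω)) f p) +
        ∫ p, triIntegrand (singleScaleKernel β (Eᶜ.indicator Ω)) f p := by
    rw [← integral_add ib ig]
    refine integral_congr_ae (Filter.Eventually.of_forall fun p ↦ ?_)
    have e := singleScaleKernel_add (β := β) (E.indicator Ω) (Eᶜ.indicator Ω) p.1
    rw [Set.indicator_self_add_compl] at e
    simp only [triIntegrand, e]
    ring
  have hbad : ‖∫ p, triIntegrand (singleScaleKernel β (E.indicator Ω)) f p‖ₑ ≤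
      16 * N * u ^ (1 - 1 / q.toReal) * R * P := by
    refine (enorm_integral_le_lintegral_enorm _).trans
      ((lintegral_triIntegrand_le (measurable_singleScaleKernel hβm mb) hf l).trans ?_)
    rw [lintegral_singleScaleKernel hβm mb]
    gcongr
    exact setLIntegral_exceptionalSet_le hm hq ht hNt
  have hu1 : u ≤ 1 := ENNReal.ofReal_le_one.mpr (inv_le_one_of_one_le₀ ht)
  have hgood : ‖∫ p, triIntegrand (singleScaleKernel β (Eᶜ.indicator Ω)) f p‖ₑ ≤
      16 * N * u ^ (1 - 1 / q.toReal) * (C * ENNReal.ofReal (8 * Real.pi)) * P := by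
    have key := enorm_integral_triIntegrand_sq_le (M := N * ENNReal.ofReal t) (δ := t⁻¹)
      (lam := t ^ 6) hβ hc hs hC mg (fun θ ↦ ?_) (by positivity) (fun θ hθ ↦ ?_) hf ig hijk
      h₀ h₁ h₂ (by positivity) hF
    · have e1 : ENNReal.ofReal (t ^ 6)⁻¹ = u ^ 6 := by
        rw [← inv_pow, ENNReal.ofReal_pow (by positivity)]
      have e2 : ENNReal.ofReal t * u = 1 := by
        rw [hu, ← ENNReal.ofReal_mul ht0.le, mul_inv_cancel₀ ht0.ne', ENNReal.ofReal_one]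
      rw [inv_inv, e1, ← hP] at key
      -- the height `t`, the distance `t⁻¹` and the frequency `t ^ 6` combine to
      -- `t ^ 2 * t * t⁻¹ ^ 6 = t⁻¹ ^ 3`, more than the square of the required gain
      have h3 : ‖∫ p, triIntegrand (singleScaleKernel β (Eᶜ.indicator Ω)) f p‖ₑ ^ 2 ≤
          (2 * (C * ENNReal.ofReal (8 * Real.pi)) * N * u * P) ^ 2 := by
        calc _ ≤ _ := key
          _ = 2 * (C * ENNReal.ofReal (8 * Real.pi) * N * P) ^ 2 * u ^ 2 * u *
                (ENNReal.ofReal t * u) ^ 3 := by ring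
          _ ≤ 4 * (C * ENNReal.ofReal (8 * Real.pi) * N * P) ^ 2 * u ^ 2 * 1 * 1 ^ 3 := by
              rw [e2]
              gcongr
              norm_num
          _ = _ := by ring
      have h4 := (ENNReal.pow_le_pow_left_iff two_ne_zero).mp h3
      have h5 : u ≤ u ^ (1 - 1 / q.toReal) := by
        conv_lhs => rw [← ENNReal.rpow_one u]
        exact ENNReal.rpow_le_rpow_of_exponent_ge hu1 (by linarith)
      calc _ ≤ _ := h4
        _ ≤ 16 * (C * ENNReal.ofReal (8 * Real.pi)) * N * u ^ (1 - 1 / q.toReal) * P := by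
            gcongr
            norm_num
        _ = _ := by ring
    · by_cases hθ : θ ∈ E
      · rw [Set.indicator_of_notMem (by simpa using hθ)]
        simp
      · rw [Set.indicator_of_mem hθ]
        exact (not_not.mp hθ).1
    · have hmem : θ ∉ E := by
        intro h
        exact hθ (Set.indicator_of_notMem (by simpa using h) _)
      exact (not_not.mp hmem).2
  rw [hsplit]
  refine (enorm_add_le _ _).trans ((add_le_add hbad hgood).trans_eq ?_)
  ring

/-! ### Passage to measurable representatives -/

/-- By polar coordinates, a null set of directions spans a null cone. -/
theorem ae_direction_of_ae {S : UnitCircle → Prop} (hS : ∀ᵐ θ ∂arcLength, S θ) :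
    ∀ᵐ y : Plane, ∀ hy : y ≠ 0, S (direction y hy) := by
  classical
  set B := toMeasurable arcLength {θ | ¬ S θ} with hB
  have hBm : MeasurableSet B := measurableSet_toMeasurable _ _
  have hB0 : arcLength B = 0 := by rw [hB, measure_toMeasurable]; exact ae_iff.mp hS
  set H : Plane → ℝ≥0∞ := fun y ↦
    if hy : y ≠ 0 then B.indicator 1 (direction y hy) else 0 with hH
  have hHm : Measurable H := by
    refine Measurable.dite (s := {y : Plane | y ≠ 0})
      (f := fun y ↦ B.indicator 1 (direction y y.2))
      (g := fun _ ↦ 0) ?_ measurable_const (measurableSet_singleton 0).compl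
    exact (measurable_one.indicator hBm).comp measurable_direction
  have hz : ∫⁻ y, H y = 0 := by
    rw [lintegral_polar hHm, lintegral_eq_zero_iff' (Measurable.aemeasurable (by fun_prop))]
    have hb : ∀ᵐ θ ∂arcLength, θ ∉ B := by rw [ae_iff]; simpa using hB0
    filter_upwards [hb] with θ hθ
    refine (setLIntegral_congr_fun measurableSet_Ioi fun r hr ↦ ?_).trans lintegral_zero
    have hr : 0 < r := hr
    simp only [hH]
    rw [dif_pos (smul_circle_ne_zero θ hr), direction_smul_circle θ hr,
      Set.indicator_of_notMem hθ, mul_zero]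
  rw [lintegral_eq_zero_iff hHm] at hz
  filter_upwards [hz] with y hy h0
  by_contra hcon
  have hmem : direction y h0 ∈ B := subset_toMeasurable _ _ hcon
  simp [hH, h0, hmem] at hy

theorem singleScaleKernel_ae_eq {β : ℝ → ℂ} {Ω Ω' : UnitCircle → ℂ} (h : Ω =ᵐ[arcLength] Ω') :
    singleScaleKernel β Ω =ᵐ[volume] singleScaleKernel β Ω' := by
  filter_upwards [ae_direction_of_ae h] with y hy
  unfold singleScaleKernel
  split_ifs with h0
  · rw [hy h0]
  · rfl

theorem quasiMeasurePreserving_sub_apply (x : ℝ) (i : Fin 2) :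
    Measure.QuasiMeasurePreserving (fun y : Plane ↦ x - y i) := by
  have h1 : Measure.QuasiMeasurePreserving (fun y : Plane ↦ y i) :=
    (Measure.quasiMeasurePreserving_eval (fun _ : Fin 2 ↦ (volume : Measure ℝ)) i).comp
      (PiLp.volume_preserving_ofLp (Fin 2)).quasiMeasurePreserving
  exact (Measure.measurePreserving_sub_left volume x).quasiMeasurePreserving.comp h1

theorem integrand_ae_eq {β : ℝ → ℂ} {Ω Ω' : UnitCircle → ℂ} {f₁ f₂ g₁ g₂ : ℝ → ℂ}
    (h : Ω =ᵐ[arcLength] Ω') (h₁ : f₁ =ᵐ[volume] g₁) (h₂ : f₂ =ᵐ[volume] g₂) (x : ℝ) :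
    (fun y : Plane ↦ singleScaleKernel β Ω y * f₁ (x - y 0) * f₂ (x - y 1)) =ᵐ[volume]
      fun y ↦ singleScaleKernel β Ω' y * g₁ (x - y 0) * g₂ (x - y 1) := by
  filter_upwards [singleScaleKernel_ae_eq h, (quasiMeasurePreserving_sub_apply x 0).ae h₁,
    (quasiMeasurePreserving_sub_apply x 1).ae h₂] with y e0 e1 e2
  rw [e0, e1, e2]

/-- Absolute convergence of the bilinear operator, by testing against a Gaussian. -/
theorem ae_integrable_integrand {K : Plane → ℂ} {f : Fin 3 → ℝ → ℂ} (hK : Measurable K)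
    (hK1 : ∫⁻ y, ‖K y‖ₑ < ⊤) (hf : ∀ i, Measurable (f i)) (l : Equiv.Perm (Fin 3))
    (h₀ : MemLp (f (l 0)) 2) (h₁ : MemLp (f (l 1)) 2) (h₂ : MemLp (f (l 2)) ⊤) :
    ∀ᵐ x : ℝ, Integrable (fun y : Plane ↦ K y * f 0 (x - y 0) * f 1 (x - y 1)) := by
  set χ : ℝ → ℂ := fun x ↦ (gaussWindow (x - 0) : ℂ) with hχ
  have hχm : Measurable χ := by fun_prop
  set g : Fin 3 → ℝ → ℂ := Function.update f 2 χ with hg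
  have g0 : g 0 = f 0 := by simp [hg]
  have g1 : g 1 = f 1 := by simp [hg]
  have g2 : g 2 = χ := by simp [hg]
  have hgm : ∀ i, Measurable (g i) := by
    intro i
    fin_cases i
    · exact g0 ▸ hf 0
    · exact g1 ▸ hf 1
    · exact g2 ▸ hχm
  have hmem : ∀ (i : Fin 3) (p : ℝ≥0∞), MemLp χ p → MemLp (f i) p → MemLp (g i) p := by
    intro i p hp hi
    by_cases h : i = 2
    · rw [h, g2]; exact hp
    · rw [hg, Function.update_of_ne h]; exact hi
  have hint := integrable_triIntegrand hK hK1 hgm l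
    (hmem _ _ (memLp_gaussWindow_two 0) h₀) (hmem _ _ (memLp_gaussWindow_two 0) h₁)
    (hmem _ _ (memLp_gaussWindow_top 0) h₂)
  filter_upwards [Integrable.prod_left_ae (μ := volume) (ν := volume) hint] with x hx
  refine (hx.mul_const (conj (χ x))⁻¹).congr (Filter.Eventually.of_forall fun y ↦ ?_)
  have h0 : conj (χ x) ≠ 0 := by
    simpa [hχ] using (gaussWindow_pos x).ne'
  simp only [triIntegrand, g0, g1, g2]
  rw [mul_inv_cancel_right₀ h0]

/-- One of the two `L²` functions occupies an input slot of the bilinear operator. -/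
theorem perm_fin_three_cases (l : Equiv.Perm (Fin 3)) :
    ((l 0 = 0 ∧ l 1 = 1 ∧ l 2 = 2) ∨ (l 0 = 0 ∧ l 1 = 2 ∧ l 2 = 1) ∨
      (l 0 = 1 ∧ l 1 = 0 ∧ l 2 = 2) ∨ (l 0 = 1 ∧ l 1 = 2 ∧ l 2 = 0)) ∨
    ((l 1 = 0 ∧ l 0 = 1 ∧ l 2 = 2) ∨ (l 1 = 0 ∧ l 0 = 2 ∧ l 2 = 1) ∨
      (l 1 = 1 ∧ l 0 = 0 ∧ l 2 = 2) ∨ (l 1 = 1 ∧ l 0 = 2 ∧ l 2 = 0)) := by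
  revert l
  decide

/-! ### The smoothing inequality -/

/-- The smoothing inequality for measurable data and an arbitrary order of the three functions. -/
theorem enorm_integral_triIntegrand_le_of_perm {β : ℝ → ℂ} {Ω : UnitCircle → ℂ} {q : ℝ≥0∞}
    {f : Fin 3 → ℝ → ℂ} {C : ℝ≥0∞} {t : ℝ} (hβ : ContDiff ℝ ∞ β) (hc : HasCompactSupport β)
    (hs : tsupport β ⊆ Set.Ioo (2⁻¹ : ℝ) 2)
    (hC : ∀ τ : ℝ, |τ| ≤ 7 → ∀ ζ, ‖𝓕 (radialWeight β τ) ζ‖ₑ ≤ C * cauchyBump ζ)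
    (hq : 1 < q) (hm : Measurable Ω) (hΩ : MemLp Ω q arcLength) (ht : 1 ≤ t)
    (hf : ∀ i, Measurable (f i)) (l : Equiv.Perm (Fin 3))
    (h₀ : MemLp (f (l 0)) 2) (h₁ : MemLp (f (l 1)) 2) (h₂ : MemLp (f (l 2)) ⊤)
    (hF₀ : ∀ᵐ ξ, |ξ| < t ^ 6 → (𝓕 (h₀.toLp (f (l 0))) : Lp ℂ 2 (volume : Measure ℝ)) ξ = 0)
    (hF₁ : ∀ᵐ ξ, |ξ| < t ^ 6 → (𝓕 (h₁.toLp (f (l 1))) : Lp ℂ 2 (volume : Measure ℝ)) ξ = 0) :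
    ‖∫ p, triIntegrand (singleScaleKernel β Ω) f p‖ₑ ≤
      16 * ((∫⁻ r in Set.Ioi (0 : ℝ), ‖β r / r‖ₑ) + C * ENNReal.ofReal (8 * Real.pi)) *
        ENNReal.ofReal t⁻¹ ^ (1 - 1 / q.toReal) * eLpNorm Ω q arcLength *
        (eLpNorm (f (l 0)) 2 volume * eLpNorm (f (l 1)) 2 volume *
          eLpNorm (f (l 2)) ⊤ volume) := by
  rcases perm_fin_three_cases l with h | h
  · exact enorm_integral_triIntegrand_le hβ hc hs hC hq hm hΩ ht hf h h₀ h₁ h₂ hF₀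
  · rw [mul_comm (eLpNorm (f (l 0)) 2 volume)]
    exact enorm_integral_triIntegrand_le hβ hc hs hC hq hm hΩ ht hf h h₁ h₀ h₂ hF₁

theorem integral_triIntegrand_eq {β : ℝ → ℂ} {Ω : UnitCircle → ℂ} {f : Fin 3 → ℝ → ℂ} (x : ℝ) :
    ∫ y, triIntegrand (singleScaleKernel β Ω) f (y, x) =
      singleScaleOp β Ω (f 0) (f 1) x * conj (f 2 x) := by
  simp only [triIntegrand, singleScaleOp]
  exact integral_mul_const _ _

theorem theorem1p2 (q : ℝ≥0∞) (hq : 1 < q) :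
    ∃ c : ℝ, 0 < c ∧
      ∀ β : ℝ → ℂ, ContDiff ℝ ∞ β → HasCompactSupport β →
        tsupport β ⊆ Set.Ioo (2⁻¹ : ℝ) 2 →
      ∃ C : ℝ, 0 < C ∧
        ∀ lam : ℝ, 1 ≤ lam →
        ∀ Ω : UnitCircle → ℂ, MemLp Ω q arcLength →
        ∀ (f : Fin 3 → ℝ → ℂ) (l : Equiv.Perm (Fin 3))
          (h₀ : MemLp (f (l 0)) 2 (volume : Measure ℝ))
          (h₁ : MemLp (f (l 1)) 2 (volume : Measure ℝ))
          (h₂ : MemLp (f (l 2)) ∞ (volume : Measure ℝ)),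
          fourierSupport h₀ ∪ fourierSupport h₁ ⊆ {ξ : ℝ | lam ≤ |ξ| ∧ |ξ| ≤ 2 * lam} →
          fourierSupport h₂ ⊆ {ξ : ℝ | |ξ| ≤ 2 * lam} →
          (∀ᵐ x : ℝ, Integrable (fun y : Plane =>
              singleScaleKernel β Ω y * f 0 (x - y 0) * f 1 (x - y 1))) ∧
          Integrable (fun x : ℝ => singleScaleOp β Ω (f 0) (f 1) x * conj (f 2 x)) ∧
          ‖∫ x : ℝ, singleScaleOp β Ω (f 0) (f 1) x * conj (f 2 x)‖ ≤
            C * lam ^ (-c) * (eLpNorm Ω q arcLength).toReal *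
              (eLpNorm (f (l 0)) 2 volume).toReal *
              (eLpNorm (f (l 1)) 2 volume).toReal *
              (eLpNorm (f (l 2)) ∞ volume).toReal := by
  obtain ⟨hq0, hq1⟩ := one_div_toReal_nonneg_lt_one hq
  refine ⟨(1 - 1 / q.toReal) / 6, by linarith, fun β hβ hc hs ↦ ?_⟩
  obtain ⟨D, hDt, hD⟩ := exists_enorm_fourier_radialWeight_le hβ hs
  set R := ∫⁻ r in Set.Ioi (0 : ℝ), ‖β r / r‖ₑ with hR
  have hRt : R < ⊤ := lintegral_radial_lt_top hβ hc hs
  set B := 16 * (R + D * ENNReal.ofReal (8 * Real.pi)) with hB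
  have hBt : B ≠ ⊤ := by finiteness
  refine ⟨B.toReal + 1, by positivity, ?_⟩
  intro lam hlam Ω hΩ f l h₀ h₁ h₂ hS₀₁ hS₂
  have hlam0 : 0 < lam := by linarith
  -- measurable representatives
  set Ω' := hΩ.1.mk Ω with hΩ'
  have eΩ : Ω =ᵐ[arcLength] Ω' := hΩ.1.ae_eq_mk
  have hm : Measurable Ω' := hΩ.1.stronglyMeasurable_mk.measurable
  have hfm : ∀ i, AEStronglyMeasurable (f i) volume := by
    intro i
    obtain ⟨m, rfl⟩ := l.surjective i
    fin_cases m
    exacts [h₀.1, h₁.1, h₂.1]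
  set g : Fin 3 → ℝ → ℂ := fun i ↦ (hfm i).mk (f i) with hg
  have eg : ∀ i, f i =ᵐ[volume] g i := fun i ↦ (hfm i).ae_eq_mk
  have hgm : ∀ i, Measurable (g i) := fun i ↦ (hfm i).stronglyMeasurable_mk.measurable
  have g₀ : MemLp (g (l 0)) 2 := h₀.ae_eq (eg _)
  have g₁ : MemLp (g (l 1)) 2 := h₁.ae_eq (eg _)
  have g₂ : MemLp (g (l 2)) ⊤ := h₂.ae_eq (eg _)
  have hΩm : MemLp Ω' q arcLength := hΩ.ae_eq eΩ
  have hKm := measurable_singleScaleKernel hβ.continuous.measurable hm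
  have hK1 : ∫⁻ y, ‖singleScaleKernel β Ω' y‖ₑ < ⊤ := by
    rw [lintegral_singleScaleKernel hβ.continuous.measurable hm]
    exact ENNReal.mul_lt_top ((lintegral_enorm_le_eLpNorm hm hq).trans_lt
      (ENNReal.mul_lt_top (by simp) hΩm.2)) hRt
  have hint := integrable_triIntegrand hKm hK1 hgm l g₀ g₁ g₂
  have hop : (fun x ↦ singleScaleOp β Ω (f 0) (f 1) x * conj (f 2 x)) =ᵐ[volume]
      fun x ↦ ∫ y, triIntegrand (singleScaleKernel β Ω') g (y, x) := by
    filter_upwards [eg 2] with x hx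
    rw [integral_triIntegrand_eq, hx]
    congr 1
    exact integral_congr_ae (integrand_ae_eq eΩ (eg 0) (eg 1) x)
  have hswap : ∫ x, singleScaleOp β Ω (f 0) (f 1) x * conj (f 2 x) =
      ∫ p, triIntegrand (singleScaleKernel β Ω') g p := by
    rw [integral_congr_ae hop]
    exact (integral_prod_symm _ hint).symm
  refine ⟨?_, hint.integral_prod_right.congr hop.symm, ?_⟩
  · filter_upwards [ae_integrable_integrand hKm hK1 hgm l g₀ g₁ g₂] with x hx
    exact hx.congr (integrand_ae_eq eΩ (eg 0) (eg 1) x).symm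
  -- with `t = lam ^ (1 / 6)`, the diagonal is cut off at distance `t⁻¹` and `Ω` at height `t`
  set t := lam ^ (1 / 6 : ℝ) with ht
  have ht1 : 1 ≤ t := Real.one_le_rpow hlam (by norm_num)
  have ht6 : t ^ 6 = lam := by
    rw [ht, ← Real.rpow_natCast, ← Real.rpow_mul hlam0.le]
    norm_num
  have hlow : ∀ i (h : MemLp (f i) 2 (volume : Measure ℝ)) (h' : MemLp (g i) 2),
      fourierSupport h ⊆ {ξ : ℝ | lam ≤ |ξ| ∧ |ξ| ≤ 2 * lam} →
      ∀ᵐ ξ, |ξ| < t ^ 6 → (𝓕 (h'.toLp (g i)) : Lp ℂ 2 (volume : Measure ℝ)) ξ = 0 := by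
    intro i h h' hsub
    rw [ht6, ← MemLp.toLp_congr h h' (eg i)]
    exact fourier_toLp_ae_eq_zero h (hsub.trans fun ξ hξ ↦ hξ.1)
  have key := enorm_integral_triIntegrand_le_of_perm hβ hc hs hD hq hm hΩm ht1 hgm l g₀ g₁ g₂
    (hlow _ h₀ g₀ (Set.subset_union_left.trans hS₀₁))
    (hlow _ h₁ g₁ (Set.subset_union_right.trans hS₀₁))
  rw [← hR, ← hB, ← hswap, ← eLpNorm_congr_ae (eg (l 0)), ← eLpNorm_congr_ae (eg (l 1)),
    ← eLpNorm_congr_ae (eg (l 2)), ← eLpNorm_congr_ae eΩ] at key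
  have hpow : (ENNReal.ofReal t⁻¹ ^ (1 - 1 / q.toReal)).toReal =
      lam ^ (-((1 - 1 / q.toReal) / 6)) := by
    rw [← ENNReal.toReal_rpow, ENNReal.toReal_ofReal (by positivity), ht,
      ← Real.rpow_neg hlam0.le, ← Real.rpow_mul hlam0.le]
    congr 1
    ring
  have hfin : B * ENNReal.ofReal t⁻¹ ^ (1 - 1 / q.toReal) * eLpNorm Ω q arcLength *
      (eLpNorm (f (l 0)) 2 volume * eLpNorm (f (l 1)) 2 volume *
        eLpNorm (f (l 2)) ⊤ volume) ≠ ⊤ :=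
    ENNReal.mul_ne_top (ENNReal.mul_ne_top (ENNReal.mul_ne_top hBt
      (ENNReal.rpow_ne_top_of_nonneg (by linarith) ENNReal.ofReal_ne_top)) hΩ.2.ne)
      (ENNReal.mul_ne_top (ENNReal.mul_ne_top h₀.2.ne h₁.2.ne) h₂.2.ne)
  have key' := ENNReal.toReal_mono hfin key
  simp only [toReal_enorm, ENNReal.toReal_mul, hpow] at key'
  refine key'.trans ?_
  rw [← mul_assoc, ← mul_assoc]
  gcongr
  linarith
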